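/- Let $\boldsymbol{\alpha}=(\alpha_2,\alpha_3,\ldots)$ be a finitely supported sequence of nonnegative integers, and put $\langle\boldsymbol{\alpha}\rangle=\sum_{j\ge2}(j-1)\alpha_j$. A \emph{minimal factorization of type} $\boldsymbol{\alpha}$ is a way of writing the $n$-cycle $(1\,2\ldots n)$, $n=\langle\boldsymbol{\alpha}\rangle+1$, as a product $\sigma_m\cdots\sigma_1$ (composed from right to left) of cycles of length at least $2$ in $S_n$, of which exactly $\alpha_j$ are $j$-cycles for each $j\ge2$; for $n=1$ the only one is the empty product. Two minimal factorizations are equivalent if one is obtained from the other by repeatedly exchanging neighbouring commuting factors. The heads (tails) of an equivalence class are the cycles that occur as the leftmost factor $\sigma_m$ (the rightmost factor $\sigma_1$) of some member of the class. Let $\widetilde H_{\boldsymbol{h},\boldsymbol{t}}(\boldsymbol{\alpha})$ be the number of equivalence classes of minimal factorizations of type $\boldsymbol{\alpha}$ that have, for each $j\ge2$, exactly $h_j$ different $j$-cycles as heads and exactly $t_j$ different $j$-cycles as tails. Define the formal power series with integer coefficients \[ g(\boldsymbol{x},\boldsymbol{v},\boldsymbol{u})=\sum_{\boldsymbol{\alpha}}\sum_{\boldsymbol{h}}\sum_{\boldsymbol{t}}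 \widetilde H_{\boldsymbol{h},\boldsymbol{t}}(\boldsymbol{\alpha})\prod_{j\ge2}x_j^{\alpha_j}u_j^{h_j}v_j^{t_j}. \] Then there is exactly one formal power series $f=f(\boldsymbol{x},\boldsymbol{v},\boldsymbol{u})$ with integer coefficients that satisfies \[ f=1+\sum_{n\ge2}x_n\,(f^n-1+v_n)\,\hat f^{\,n-1},\qquad \hat f(\boldsymbol{x},\boldsymbol{v},\boldsymbol{u})=f(\boldsymbol{x},\boldsymbol{u},\boldsymbol{v}), \] and with this $f$ \[ g=f-\sum_{n\ge2}x_n(1-u_n)f^n+\sum_{n\ge2}x_n(1-u_n)(1-v_n) =f\hat f-\sum_{n\ge2}x_n(f\hat f)^n+\sum_{n\ge2}x_n(1-u_n)(1-v_n). \] -/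

import Mathlib

open scoped MvPowerSeries.WithPiTopology

noncomputable section

namespace CycleFactorization

open Equiv

/-- The possible lengths of the factors: the integers `j ≥ 2`. -/
abbrev Len : Type := {j : ℕ // 2 ≤ j}

/-- `⟨α⟩ = ∑ (j - 1) α_j`, where `α_j` is the number of `j`-cycles. -/
def rank (α : Len →₀ ℕ) : ℕ := α.sum fun j a => (j.1 - 1) * a

/-- The list `[σ_m, …, σ_1]` of permutations is a factorization of type `α` of the `n`-cycle
`(1 2 … n)`: every factor is a cycle of length at least two, exactly `α_j` of the factors are
`j`-cycles, and `σ_m ⋯ σ_1 = (1 2 … n)` (products are composed from right to left; the `n` points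
are `0, …, n - 1`). For `n = 1` the `n`-cycle is the identity. -/
structure IsFactorization (n : ℕ) (α : Len →₀ ℕ) (L : List (Perm (Fin n))) : Prop where
  isCycle : ∀ σ ∈ L, σ.IsCycle
  type_eq : ∀ j : Len, (L.filter fun σ => σ.support.card = j.1).length = α j
  prod_eq : L.prod = finRotate n

/-- The minimal factorizations of type `α`: those with `⟨α⟩ = n - 1`, that is, the factorizations
of type `α` of the `n`-cycle with `n = ⟨α⟩ + 1`. -/
def MinFactorization (α : Len →₀ ℕ) : Type :=
  {L : List (Perm (Fin (rank α + 1))) // IsFactorization (rank α + 1) α L}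

/-- Two lists differ by exchanging two neighbouring commuting factors. -/
def Swap {n : ℕ} (L L' : List (Perm (Fin n))) : Prop :=
  ∃ (A B : List (Perm (Fin n))) (σ τ : Perm (Fin n)),
    Commute σ τ ∧ L = A ++ σ :: τ :: B ∧ L' = A ++ τ :: σ :: B

/-- Equivalence of minimal factorizations: they differ only in the order of commuting factors.
(An exchange of neighbouring commuting factors turns a factorization into a factorization of the
same type, so that it does not matter that the intermediate lists are not restricted.) -/
instance equivalence (α : Len →₀ ℕ) : Setoid (MinFactorization α) :=
  (Relation.EqvGen.setoid Swap).comap Subtype.val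

/-- Inequivalent minimal factorizations of type `α`, that is, equivalence classes. -/
def FactClass (α : Len →₀ ℕ) : Type := Quotient (equivalence α)

/-- The heads of a class: the cycles that can appear in the position `σ_m`. -/
def heads {α : Len →₀ ℕ} (c : FactClass α) : Set (Perm (Fin (rank α + 1))) :=
  {σ | ∃ L : MinFactorization α, Quotient.mk (equivalence α) L = c ∧ L.1.head? = some σ}

/-- The tails of a class: the cycles that can appear in the position `σ_1`. -/
def tails {α : Len →₀ ℕ} (c : FactClass α) : Set (Perm (Fin (rank α + 1))) :=
  {σ | ∃ L : MinFactorization α, Quotient.mk (equivalence α) L = c ∧ L.1.getLast? = some σ}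

/-- The number of different `j`-cycle heads. -/
def headCount {α : Len →₀ ℕ} (c : FactClass α) (j : Len) : ℕ :=
  {σ | σ ∈ heads c ∧ σ.support.card = j.1}.ncard

/-- The number of different `j`-cycle tails. -/
def tailCount {α : Len →₀ ℕ} (c : FactClass α) (j : Len) : ℕ :=
  {σ | σ ∈ tails c ∧ σ.support.card = j.1}.ncard

/-- The number of inequivalent minimal factorizations of type `α` with `h_j` heads and `t_j` tails
that are `j`-cycles, for every `j`. -/
def numFact (α h t : Len →₀ ℕ) : ℕ :=
  {c : FactClass α | (∀ j, headCount c j = h j) ∧ (∀ j, tailCount c j = t j)}.ncard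

/-- The variables `x_j`, `v_j`, `u_j`, for `j ≥ 2`. -/
inductive Var : Type
  | x (j : Len)
  | v (j : Len)
  | u (j : Len)

/-- Formal power series with integer coefficients in all the variables `x_j`, `v_j`, `u_j`. -/
abbrev Series : Type := MvPowerSeries Var ℤ

/-- The variable `x_j` as a power series. -/
def x (j : Len) : Series := MvPowerSeries.X (Var.x j)

/-- The variable `v_j` as a power series. -/
def v (j : Len) : Series := MvPowerSeries.X (Var.v j)

/-- The variable `u_j` as a power series. -/
def u (j : Len) : Series := MvPowerSeries.X (Var.u j)

/-- The generating function `g(x, v, u)`: the coefficient of `∏ x_j ^ α_j * u_j ^ h_j * v_j ^ t_j`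
is the number of inequivalent minimal factorizations of type `α` with head vector `h` and tail
vector `t`. -/
def g : Series := fun e =>
  (numFact
    (e.comapDomain Var.x (fun _ _ _ _ hab => Var.x.inj hab))
    (e.comapDomain Var.u (fun _ _ _ _ hab => Var.u.inj hab))
    (e.comapDomain Var.v (fun _ _ _ _ hab => Var.v.inj hab)) : ℤ)

/-- The exchange of `u_j` and `v_j` for all `j`. -/
def swapVar : Var ≃ Var where
  toFun
    | .x j => .x j
    | .v j => .u j
    | .u j => .v j
  invFun
    | .x j => .x j
    | .v j => .u j
    | .u j => .v j
  left_inv := by rintro (j | j | j) <;> rfl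
  right_inv := by rintro (j | j | j) <;> rfl

/-- `hat f (x, v, u) = f (x, u, v)`. -/
def hat (f : Series) : Series := MvPowerSeries.renameEquiv ℤ swapVar f

/-- Every series `∑ x_n * G_n` converges coefficientwise, whatever the power series `G_n` are; the
infinite sums below are therefore genuine ones. -/
theorem summable_x_mul (G : Len → Series) : Summable fun n => x n * G n := by
  classical
  rw [MvPowerSeries.WithPiTopology.summable_iff_summable_coeff]
  intro d
  have hfin : (Var.x ⁻¹' (d.support : Set Var)).Finite :=
    d.support.finite_toSet.preimage (fun _ _ _ _ hab => Var.x.inj hab)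
  refine summable_of_hasFiniteSupport (hfin.subset ?_)
  intro n hn
  by_contra hnot
  apply hn
  have h0 : ¬ Finsupp.single (Var.x n) 1 ≤ d := by
    intro hle
    have := hle (Var.x n)
    simp only [Finsupp.single_eq_same] at this
    exact hnot (by simp; omega)
  simp only [x, MvPowerSeries.X]
  rw [MvPowerSeries.coeff_monomial_mul, if_neg h0]

/-- The recursion `f = 1 + ∑_{n ≥ 2} x_n (f ^ n - 1 + v_n) f̂ ^ (n - 1)`. -/
def SolvesRecursion (f : Series) : Prop :=
  f = 1 + ∑' n : Len, x n * ((f ^ n.1 - 1 + v n) * hat f ^ (n.1 - 1))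

end CycleFactorization

end

/-!
Cut a minimal factorization of a cycle through the points of a list at its leftmost factor `C` that
moves the first point. The factors to the right of `C` are minimal factorizations of cycles through
intervals that begin with the points of `C`, the factors to the left of `C` are minimal
factorizations of cycles through intervals that end with these points, and nothing remains to the
left of `C` at the first point. Factors in different pieces commute if they are on the same side
of `C`, so that equivalence classes correspond to trees with an `m`-cycle at each node and with
`m + (m - 1)` subtrees below it.

Reversing a piece on the left turns its last point into its first one and exchanges heads and tails,
which accounts for the factor `f̂ ^ (n - 1)` in the recursion. The cycle `C` is a tail if all the
pieces on the right are empty, which replaces the term `1` of `f ^ n` by `v_n`. In `f` the root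
cycle is never counted as a head, since only those heads of a piece that fix its first point remain
heads of the factorization; counting it yields `g`.

The right side of the recursion determines the terms of degree at most `N + 1` of `f` by those of
degree at most `N`, hence `f` is unique. The two expressions for `g` agree because the recursion,
multiplied by `f̂`, expresses the symmetric series `f f̂ - ∑ x_n (f f̂) ^ n` by `f̂`, and then
also by `f`.
-/

noncomputable section

namespace CycleFactorization

open Equiv

/-! ### Trace equivalence -/

section TraceEquivalence

variable {M : Type*}

/-- Two lists differ by exchanging two neighbouring commuting entries. On lists of permutations of
`Fin n` this is `Swap`. -/
def CommSwap [Mul M] (L L' : List M) : Prop :=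
  ∃ (A B : List M) (a b : M), Commute a b ∧ L = A ++ a :: b :: B ∧ L' = A ++ b :: a :: B

/-- Trace equivalence of lists: equality up to repeated exchanges of neighbouring commuting
entries. -/
def TraceEquiv [Mul M] : List M → List M → Prop := Relation.EqvGen CommSwap

namespace TraceEquiv

section Mul

variable [Mul M] {L L' L₁ L₂ L₃ : List M}

@[refl]
theorem refl (L : List M) : TraceEquiv L L := Relation.EqvGen.refl L

@[symm]
theorem symm (h : TraceEquiv L L') : TraceEquiv L' L := Relation.EqvGen.symm _ _ h

@[trans]
theorem trans (h : TraceEquiv L₁ L₂) (h' : TraceEquiv L₂ L₃) : TraceEquiv L₁ L₃ :=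
  Relation.EqvGen.trans _ _ _ h h'

instance : Trans (TraceEquiv (M := M)) TraceEquiv TraceEquiv := ⟨trans⟩

theorem swap (A B : List M) {a b : M} (h : Commute a b) :
    TraceEquiv (A ++ a :: b :: B) (A ++ b :: a :: B) :=
  Relation.EqvGen.rel _ _ ⟨A, B, a, b, h, rfl, rfl⟩

theorem rel_of_swap {r : List M → List M → Prop} (hr : Equivalence r)
    (hswap : ∀ A B a b, Commute a b → r (A ++ a :: b :: B) (A ++ b :: a :: B))
    (h : TraceEquiv L L') : r L L' := by
  refine hr.eqvGen_iff.1 (Relation.EqvGen.mono ?_ _ _ h)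
  rintro _ _ ⟨A, B, a, b, hc, rfl, rfl⟩
  exact hswap A B a b hc

theorem map_of_swap {N : Type*} [Mul N] (F : List M → List N)
    (hswap : ∀ A B a b, Commute a b → TraceEquiv (F (A ++ a :: b :: B)) (F (A ++ b :: a :: B)))
    (h : TraceEquiv L L') : TraceEquiv (F L) (F L') :=
  h.rel_of_swap (r := fun X Y => TraceEquiv (F X) (F Y)) ⟨fun _ => refl _, symm, trans⟩ hswap

theorem perm (h : TraceEquiv L L') : L.Perm L' :=
  h.rel_of_swap ⟨List.Perm.refl, List.Perm.symm, List.Perm.trans⟩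
    fun A B a b _ => (List.Perm.swap b a B).append_left A

theorem filter (p : M → Bool) (h : TraceEquiv L L') : TraceEquiv (L.filter p) (L'.filter p) :=
  h.map_of_swap (List.filter p) fun A B a b hc => by
    simp only [List.filter_append, List.filter_cons]
    split_ifs
    · exact swap _ _ hc
    all_goals rfl

theorem append_left (X : List M) (h : TraceEquiv L L') : TraceEquiv (X ++ L) (X ++ L') :=
  h.map_of_swap (X ++ ·) fun A B a b hc => by
    simpa only [List.append_assoc] using swap (X ++ A) B hc

theorem append_right (X : List M) (h : TraceEquiv L L') : TraceEquiv (L ++ X) (L' ++ X) :=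
  h.map_of_swap (· ++ X) fun A B a b hc => by
    simpa only [List.append_assoc, List.cons_append] using swap A (B ++ X) hc

theorem append (h : TraceEquiv L L') (h' : TraceEquiv L₁ L₂) :
    TraceEquiv (L ++ L₁) (L' ++ L₂) :=
  (h.append_right L₁).trans (h'.append_left L')

theorem cons (a : M) (h : TraceEquiv L L') : TraceEquiv (a :: L) (a :: L') := h.append_left [a]

theorem flatten_ofFn {k : ℕ} {A B : Fin k → List M} (h : ∀ i, TraceEquiv (A i) (B i)) :
    TraceEquiv (List.ofFn A).flatten (List.ofFn B).flatten := by
  induction k with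
  | zero => simp only [List.ofFn_zero]; rfl
  | succ k ih =>
    simp only [List.ofFn_succ, List.flatten_cons]
    exact (h 0).append (ih fun i => h i.succ)

theorem reverse (h : TraceEquiv L L') : TraceEquiv L.reverse L'.reverse :=
  h.map_of_swap List.reverse fun A B a b hc => by
    simpa only [List.reverse_append, List.reverse_cons, List.append_assoc, List.cons_append,
      List.nil_append] using swap B.reverse A.reverse hc.symm

theorem append_cons {A : List M} {a : M} (h : ∀ b ∈ A, Commute b a) (B : List M) :
    TraceEquiv (A ++ a :: B) (a :: (A ++ B)) := by
  induction A with
  | nil => rfl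
  | cons b A ih =>
    calc TraceEquiv (b :: (A ++ a :: B)) (b :: a :: (A ++ B)) :=
          (ih fun c hc => h c (List.mem_cons_of_mem _ hc)).cons b
      TraceEquiv _ (a :: b :: (A ++ B)) := swap [] _ (h b List.mem_cons_self)

theorem append_comm {A B : List M} (h : ∀ a ∈ A, ∀ b ∈ B, Commute a b) :
    TraceEquiv (A ++ B) (B ++ A) := by
  induction B with
  | nil => rw [List.append_nil]; rfl
  | cons b B ih =>
    exact (append_cons (fun a ha => h a ha b List.mem_cons_self) B).trans <|
      (ih fun a ha c hc => h a ha c (List.mem_cons_of_mem _ hc)).cons b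

theorem filter_append_filter_not {p : M → Prop} [DecidablePred p]
    (h : L.Pairwise fun a b => ¬ p a → p b → Commute a b) :
    TraceEquiv L (L.filter (p ·) ++ L.filter (¬ p ·)) := by
  induction L with
  | nil => rfl
  | cons a L ih =>
    rw [List.pairwise_cons] at h
    refine ((ih h.2).cons a).trans ?_
    by_cases ha : p a
    · simp only [ha, decide_true, not_true_eq_false, decide_false, List.filter_cons_of_pos,
        List.cons_append, List.filter_cons_of_neg, Bool.false_eq_true, not_false_eq_true]
      rfl
    · simp only [ha, decide_false, not_false_eq_true, decide_true, List.filter_cons_of_pos,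
        List.filter_cons_of_neg, Bool.false_eq_true]
      refine (append_cons (fun b hb => ?_) _).symm
      rw [List.mem_filter, decide_eq_true_iff] at hb
      exact (h.1 b hb.1 ha hb.2).symm

theorem flatten_filter_key {key : M → ℕ} {k : ℕ} (hk : ∀ a ∈ L, key a < k)
    (h : ∀ a ∈ L, ∀ b ∈ L, key a ≠ key b → Commute a b) :
    TraceEquiv L (List.ofFn fun i : Fin k => L.filter (key · = i.val)).flatten := by
  induction k generalizing L with
  | zero => rw [List.eq_nil_iff_forall_not_mem.2 fun a ha => (hk a ha).not_ge (Nat.zero_le _)]; rfl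
  | succ k ih =>
    have hsplit : TraceEquiv L (L.filter (key · < k) ++ L.filter (¬ key · < k)) :=
      filter_append_filter_not <| List.pairwise_of_forall_mem_list fun a ha b hb hka hkb =>
        h a ha b hb (by omega)
    refine hsplit.trans ?_
    rw [List.ofFn_succ', List.concat_eq_append, List.flatten_concat]
    have hlast : L.filter (¬ key · < k) = L.filter (key · = k) := by
      refine List.filter_congr fun a ha => ?_
      have := hk a ha
      simp only [decide_eq_decide]
      omega
    have hinit : ∀ i : Fin k,
        (L.filter (key · < k)).filter (key · = i.val) = L.filter (key · = i.val) := fun i => by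
      rw [List.filter_filter]
      refine List.filter_congr fun a _ => ?_
      have := i.isLt
      simp only [← Bool.decide_and, decide_eq_decide]
      omega
    rw [hlast]
    refine append_right _ ?_
    simp only [Fin.val_castSucc, ← hinit]
    exact ih (fun a ha => of_decide_eq_true (List.mem_filter.1 ha).2) fun a ha b hb =>
      h a (List.mem_filter.1 ha).1 b (List.mem_filter.1 hb).1

end Mul

theorem prod_eq [Monoid M] {L L' : List M} (h : TraceEquiv L L') : L.prod = L'.prod :=
  h.rel_of_swap (r := fun X Y => X.prod = Y.prod) ⟨fun _ => rfl, Eq.symm, Eq.trans⟩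
    fun A B a b hc => by
      simp only [List.prod_append, List.prod_cons, ← mul_assoc a, ← mul_assoc b, hc.eq]

end TraceEquiv

section Heads

variable [Mul M] {L L' X Y : List M} {a : M}

/-- `a` occurs in the list with only entries that commute with it to the left of it, so that it can
be moved to the front. -/
def IsHead : List M → M → Prop
  | [], _ => False
  | b :: L, a => b = a ∨ (Commute b a ∧ IsHead L a)

/-- `a` occurs in the list with only entries that commute with it to the right of it, so that it can
be moved to the end. -/
def IsTail (L : List M) (a : M) : Prop := IsHead L.reverse a

theorem IsHead.mem (h : IsHead L a) : a ∈ L := by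
  induction L with
  | nil => exact h.elim
  | cons b L ih =>
    rcases h with rfl | ⟨_, h⟩
    · exact List.mem_cons_self
    · exact List.mem_cons_of_mem _ (ih h)

theorem IsTail.mem (h : IsTail L a) : a ∈ L := List.mem_reverse.1 (IsHead.mem h)

theorem isHead_append :
    IsHead (X ++ Y) a ↔ IsHead X a ∨ ((∀ b ∈ X, Commute b a) ∧ IsHead Y a) := by
  induction X with
  | nil => simp [IsHead]
  | cons b X ih =>
    simp only [List.cons_append, IsHead, ih, List.forall_mem_cons]
    tauto

theorem isTail_append :
    IsTail (X ++ Y) a ↔ IsTail Y a ∨ ((∀ b ∈ Y, Commute b a) ∧ IsTail X a) := by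
  simp only [IsTail, List.reverse_append, isHead_append, List.mem_reverse]

theorem isTail_cons {b : M} :
    IsTail (b :: Y) a ↔ IsTail Y a ∨ ((∀ c ∈ Y, Commute c a) ∧ b = a) := by
  rw [← List.singleton_append, isTail_append]
  simp [IsTail, IsHead]

theorem TraceEquiv.isHead_iff (h : TraceEquiv L L') : IsHead L a ↔ IsHead L' a :=
  h.rel_of_swap (r := fun X Y => IsHead X a ↔ IsHead Y a) ⟨fun _ => Iff.rfl, Iff.symm, Iff.trans⟩
    fun A B b c hc => by
      simp only [isHead_append, IsHead]
      have hb : b = a → Commute c a := fun h => h ▸ hc.symm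
      have hc' : c = a → Commute b a := fun h => h ▸ hc
      tauto

theorem TraceEquiv.isTail_iff (h : TraceEquiv L L') : IsTail L a ↔ IsTail L' a :=
  h.reverse.isHead_iff

theorem isHead_iff_exists_traceEquiv : IsHead L a ↔ ∃ L', TraceEquiv L (a :: L') := by
  refine ⟨fun h => ?_, fun ⟨L', h⟩ => h.isHead_iff.2 (Or.inl rfl)⟩
  induction L with
  | nil => exact h.elim
  | cons b L ih =>
    rcases h with rfl | ⟨hc, h⟩
    · exact ⟨L, TraceEquiv.refl _⟩
    · obtain ⟨L', hL'⟩ := ih h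
      exact ⟨b :: L', (hL'.cons b).trans (TraceEquiv.swap [] _ hc)⟩

theorem isTail_iff_exists_traceEquiv : IsTail L a ↔ ∃ L', TraceEquiv L (L' ++ [a]) := by
  rw [IsTail, isHead_iff_exists_traceEquiv]
  refine ⟨fun ⟨L', h⟩ => ⟨L'.reverse, by simpa using h.reverse⟩, fun ⟨L', h⟩ => ⟨L'.reverse, ?_⟩⟩
  simpa using h.reverse

theorem isHead_flatten {Ls : List (List M)}
    (h : Ls.Pairwise fun X Y => ∀ b ∈ X, ∀ c ∈ Y, Commute b c) :
    IsHead Ls.flatten a ↔ ∃ X ∈ Ls, IsHead X a := by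
  induction Ls with
  | nil => simp [IsHead]
  | cons X Ls ih =>
    rw [List.pairwise_cons] at h
    rw [List.flatten_cons, isHead_append, ih h.2, List.exists_mem_cons_iff]
    refine or_congr_right (and_iff_right_of_imp ?_)
    rintro ⟨Y, hY, ha⟩ b hb
    exact h.1 Y hY b hb a ha.mem

theorem isTail_flatten {Ls : List (List M)}
    (h : Ls.Pairwise fun X Y => ∀ b ∈ X, ∀ c ∈ Y, Commute b c) :
    IsTail Ls.flatten a ↔ ∃ X ∈ Ls, IsTail X a := by
  rw [IsTail, List.reverse_flatten, isHead_flatten]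
  · simp only [List.mem_reverse, List.mem_map, exists_exists_and_eq_and, IsTail]
  · rw [List.pairwise_reverse, List.pairwise_map]
    refine h.imp fun hXY b hb c hc => ?_
    exact (hXY c (List.mem_reverse.1 hc) b (List.mem_reverse.1 hb)).symm

end Heads

section RevInv

variable [Group M] {L L' : List M} {a : M}

/-- The inverses of the entries in the reverse order: the mirror image of a factorization. -/
def revInv (L : List M) : List M := (L.map (·⁻¹)).reverse

theorem revInv_revInv (L : List M) : revInv (revInv L) = L := by simp [revInv, List.map_reverse]

theorem mem_revInv : a ∈ revInv L ↔ a⁻¹ ∈ L := by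
  simp only [revInv, List.mem_reverse, List.mem_map]
  exact ⟨by rintro ⟨b, h, rfl⟩; rwa [inv_inv], fun h => ⟨_, h, inv_inv a⟩⟩

theorem prod_revInv (L : List M) : (revInv L).prod = L.prod⁻¹ := (List.prod_inv_reverse L).symm

theorem revInv_eq_nil : revInv L = [] ↔ L = [] := by simp [revInv]

theorem TraceEquiv.revInv (h : TraceEquiv L L') :
    TraceEquiv (CycleFactorization.revInv L) (CycleFactorization.revInv L') :=
  TraceEquiv.reverse <| h.map_of_swap (List.map (·⁻¹)) fun A B a b hc => by
    simpa only [List.map_append, List.map_cons] using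
      TraceEquiv.swap (A.map (·⁻¹)) (B.map (·⁻¹)) hc.inv_inv

theorem isHead_map_inv : IsHead (L.map (·⁻¹)) a ↔ IsHead L a⁻¹ := by
  induction L with
  | nil => rfl
  | cons b L ih =>
    have hcomm : Commute b⁻¹ a ↔ Commute b a⁻¹ := by
      rw [Commute.inv_left_iff, Commute.inv_right_iff]
    simp only [List.map_cons, IsHead, ih, inv_eq_iff_eq_inv, hcomm]

theorem isTail_revInv : IsTail (revInv L) a ↔ IsHead L a⁻¹ := by
  rw [IsTail, revInv, List.reverse_reverse, isHead_map_inv]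

theorem isHead_revInv : IsHead (revInv L) a ↔ IsTail L a⁻¹ := by
  rw [IsTail, revInv, ← List.map_reverse, isHead_map_inv]

end RevInv

end TraceEquivalence

/-! ### The cycle through the entries of a list -/

section FormPerm

variable {V : Type*}

theorem eq_of_sameCycle {W : Type*} {κ : V → W} {σ : Perm V} (h : ∀ x, κ (σ x) = κ x) {x y : V}
    (hxy : σ.SameCycle x y) : κ x = κ y := by
  obtain ⟨i, rfl⟩ := hxy
  induction i with
  | zero => rfl
  | succ i ih => rw [add_comm, zpow_one_add, Perm.mul_apply, h, ih]
  | pred i ih =>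
    rw [ih, ← h ((σ ^ (-(i : ℤ) - 1)) x), ← Perm.mul_apply, ← zpow_one_add, add_sub_cancel]

variable [DecidableEq V]

theorem formPerm_append_cons (X Y : List V) (w : V) :
    (X ++ w :: Y).formPerm = (X ++ [w]).formPerm * (w :: Y).formPerm := by
  induction X with
  | nil => simp
  | cons x X ih =>
    cases X with
    | nil => simp
    | cons x' X =>
      simp only [List.cons_append, List.formPerm_cons_cons] at ih ⊢
      rw [ih, mul_assoc]

theorem formPerm_append_comm {X Y : List V} (h : (X ++ Y).Nodup) :
    (X ++ Y).formPerm = (Y ++ X).formPerm :=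
  List.formPerm_eq_of_isRotated h List.isRotated_append

theorem formPerm_cons_append {w : V} {X Y : List V} (h : (w :: (X ++ Y)).Nodup) :
    (w :: (X ++ Y)).formPerm = (w :: Y).formPerm * (w :: X).formPerm :=
  calc (w :: (X ++ Y)).formPerm = (Y ++ w :: X).formPerm := formPerm_append_comm (X := w :: X) h
    _ = (Y ++ [w]).formPerm * (w :: X).formPerm := formPerm_append_cons Y X w
    _ = (w :: Y).formPerm * (w :: X).formPerm := by
      rw [← formPerm_append_comm (X := [w]) (h.sublist (by simp)), List.singleton_append]

theorem disjoint_formPerm {X Y : List V} (h : X.Disjoint Y) :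
    Perm.Disjoint X.formPerm Y.formPerm := fun x => by
  by_cases hx : x ∈ X
  · exact Or.inr (List.formPerm_apply_of_notMem fun hy => h hx hy)
  · exact Or.inl (List.formPerm_apply_of_notMem hx)

theorem commute_formPerm_prod {k : ℕ} {X : List V} {Y : Fin k → List V}
    (h : ∀ i, X.Disjoint (Y i)) : Commute X.formPerm (List.ofFn fun i => (Y i).formPerm).prod := by
  refine (Perm.disjoint_prod_right _ fun σ hσ => ?_).commute
  obtain ⟨i, rfl⟩ := List.mem_ofFn.1 hσ
  exact disjoint_formPerm (h i)

theorem formPerm_cons_append_singleton {a b : V} {l : List V} (h : (a :: (l ++ [b])).Nodup) :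
    (a :: (l ++ [b])).formPerm = (l ++ [b]).formPerm * swap a b := by
  rw [← List.singleton_append, formPerm_append_comm h, List.append_assoc, List.singleton_append,
    formPerm_append_cons, List.formPerm_pair, swap_comm]

theorem formPerm_cons_flatten_ofFn {k : ℕ} (a : V) (α β : Fin k → List V) (w : Fin k → V)
    (h : (a :: (List.ofFn fun i => α i ++ w i :: β i).flatten).Nodup) :
    (a :: (List.ofFn fun i => α i ++ w i :: β i).flatten).formPerm =
      (List.ofFn fun i => (α i ++ [w i]).formPerm).prod * (a :: List.ofFn w).formPerm *
        (List.ofFn fun i => (w i :: β i).formPerm).prod := by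
  induction k generalizing a with
  | zero => simp
  | succ k ih =>
    simp only [List.ofFn_succ, List.flatten_cons, List.prod_cons] at h ⊢
    set X := (List.ofFn fun i : Fin k => α i.succ ++ w i.succ :: β i.succ).flatten with hX
    set left := (List.ofFn fun i : Fin k => (α i.succ ++ [w i.succ]).formPerm).prod with hleft
    set right := (List.ofFn fun i : Fin k => (w i.succ :: β i.succ).formPerm).prod with hright
    have hblock : ∀ i : Fin k, α i.succ ++ w i.succ :: β i.succ ⊆ X := fun i _ hx =>
      List.mem_flatten_of_mem (List.mem_ofFn.2 ⟨i, rfl⟩) hx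
    have hwX : (w 0 :: X).Nodup := h.sublist <| .cons _ <|
      ((List.sublist_append_right (β 0) X).cons_cons _).trans (by simp)
    have hdisj : List.Disjoint (a :: (α 0 ++ w 0 :: β 0)) X := List.disjoint_of_nodup_append h
    have hswap : Commute (swap a (w 0)) left := by
      rw [← List.formPerm_pair]
      refine commute_formPerm_prod fun i x hx hx' => hdisj (a := x) ?_ (hblock i ?_)
      · grind
      · grind
    have hcomm : Commute (w 0 :: β 0).formPerm right :=
      commute_formPerm_prod fun i x hx hx' =>
        hdisj (List.mem_cons_of_mem _ (List.mem_append_right _ hx))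
          (hblock i (List.mem_append_right _ hx'))
    calc (a :: (α 0 ++ w 0 :: β 0 ++ X)).formPerm
        = (a :: (α 0 ++ [w 0])).formPerm * (w 0 :: (β 0 ++ X)).formPerm := by
          rw [List.append_assoc, List.cons_append, ← List.cons_append, formPerm_append_cons,
            List.cons_append]
      _ = (α 0 ++ [w 0]).formPerm * swap a (w 0) *
            ((w 0 :: X).formPerm * (w 0 :: β 0).formPerm) := by
          rw [formPerm_cons_append_singleton (h.sublist (by simp)),
            formPerm_cons_append (h.sublist (by simp))]
      _ = (α 0 ++ [w 0]).formPerm * (swap a (w 0) * left) *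
            (w 0 :: List.ofFn fun i : Fin k => w i.succ).formPerm *
              (right * (w 0 :: β 0).formPerm) := by
          rw [hX, ih (w 0) _ _ _ hwX]
          simp only [mul_assoc, hleft, hright]
      _ = _ := by
          rw [hswap.eq, ← hcomm.eq, List.formPerm_cons_cons]
          simp only [mul_assoc]

theorem formPerm_flatten_ofFn {m : ℕ} {α β : Fin (m + 1) → List V} {w : Fin (m + 1) → V}
    (h₀ : α 0 = []) (h : (List.ofFn fun i => α i ++ w i :: β i).flatten.Nodup) :
    (List.ofFn fun i => α i ++ w i :: β i).flatten.formPerm =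
      (List.ofFn fun i => (α i ++ [w i]).formPerm).prod * (List.ofFn w).formPerm *
        (List.ofFn fun i => (w i :: β i).formPerm).prod := by
  simp only [List.ofFn_succ, List.flatten_cons, List.prod_cons, h₀, List.nil_append,
    List.cons_append, List.formPerm_singleton, one_mul] at h ⊢
  have hcomm : Commute (w 0 :: β 0).formPerm
      (List.ofFn fun i : Fin m => (w i.succ :: β i.succ).formPerm).prod :=
    commute_formPerm_prod fun i _ hx hx' =>
      List.disjoint_of_nodup_append (l₁ := w 0 :: β 0) h hx <|
        List.mem_flatten_of_mem (List.mem_ofFn.2 ⟨i, rfl⟩) (List.mem_append_right _ hx')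
  rw [formPerm_cons_append h, formPerm_cons_flatten_ofFn _ _ _ _ (h.sublist (by simp)), mul_assoc,
    ← hcomm.eq]

theorem eq_of_formPerm_eq_of_head {a : V} {X Y : List V} (hX : (a :: X).Nodup)
    (hY : (a :: Y).Nodup) (h : (a :: X).formPerm = (a :: Y).formPerm) : X = Y := by
  rcases (List.formPerm_eq_formPerm_iff hX hY).1 h with ⟨k, hk⟩ | ⟨hX', hY'⟩
  · have hlt : k % (a :: X).length < (a :: X).length := Nat.mod_lt _ (Nat.succ_pos _)
    have hhead : (a :: X)[k % (a :: X).length] = (a :: X)[0] := by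
      have := congrArg List.head? hk
      rw [← List.rotate_mod, List.head?_rotate hlt, List.getElem?_eq_getElem hlt] at this
      exact Option.some_injective _ this
    rw [← List.rotate_mod, (hX.getElem_inj_iff).1 hhead, List.rotate_zero] at hk
    exact List.tail_eq_of_cons_eq hk
  · rw [List.length_cons] at hX' hY'
    rw [List.length_eq_zero_iff.1 (by omega : X.length = 0),
      List.length_eq_zero_iff.1 (by omega : Y.length = 0)]

theorem exists_eq_formPerm_cons [Finite V] {σ : Perm V} {w : V}
    (h : ∀ x, ¬σ.SameCycle w x → σ x = x) :
    ∃ X : List V, σ = (w :: X).formPerm ∧ (w :: X).Nodup ∧ ∀ x, x ∈ w :: X ↔ σ.SameCycle w x := by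
  cases nonempty_fintype V
  by_cases hw : w ∈ σ.support
  · have hcycle : σ.cycleOf w = σ := Perm.ext fun x => by
      rw [Perm.cycleOf_apply]
      split_ifs with hx
      exacts [rfl, (h x hx).symm]
    obtain ⟨X, hX⟩ : ∃ X, σ.toList w = w :: X := by
      obtain ⟨n, hn⟩ := Nat.exists_eq_succ_of_ne_zero
        (Finset.card_ne_zero_of_mem (Perm.mem_support_cycleOf_iff.2 ⟨.refl σ w, hw⟩))
      exact ⟨_, by rw [Perm.toList, hn, List.iterate]⟩
    refine ⟨X, ?_, hX ▸ Perm.nodup_toList σ w, fun x => ?_⟩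
    · rw [← hX, Perm.formPerm_toList, hcycle]
    · rw [← hX, Perm.mem_toList_iff, and_iff_left hw]
  · have hfix : Function.IsFixedPt σ w := Perm.notMem_support.1 hw
    have hsame : ∀ x, σ.SameCycle w x ↔ x = w := fun x =>
      ⟨fun hx => (hx.eq_of_left hfix).symm, fun hx => hx ▸ Perm.SameCycle.refl _ _⟩
    refine ⟨[], Perm.ext fun x => ?_, List.nodup_singleton w, fun x => by simp [hsame]⟩
    rw [List.formPerm_singleton, Perm.one_apply]
    by_cases hx : x = w
    · exact hx ▸ hfix
    · exact h x (mt (hsame x).1 hx)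

end FormPerm

/-! ### Labellings of the vertices of a hypergraph -/

section Labelling

variable {W ι : Type*}

theorem exists_merge [DecidableEq W] (T : Finset W) {e : Finset W} (he : e.Nonempty) :
    ∃ f : W → W, (∀ x ∈ e, ∀ y ∈ e, f x = f y) ∧ T.card ≤ (T.image f).card + (e.card - 1) := by
  obtain ⟨s, hs⟩ := he
  refine ⟨fun x => if x ∈ e then s else x, fun x hx y hy => by simp only [hx, hy, if_true], ?_⟩
  have hsub : T ⊆ (T.image fun x => if x ∈ e then s else x) ∪ e.erase s := fun x hx => by
    by_cases hxs : x ∈ e.erase s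
    · exact Finset.mem_union_right _ hxs
    · refine Finset.mem_union_left _ (Finset.mem_image.2 ⟨x, hx, ?_⟩)
      split_ifs with hxe
      · exact (by_contra fun h => hxs (Finset.mem_erase.2 ⟨Ne.symm h, hxe⟩))
      · rfl
  calc T.card ≤ _ := Finset.card_le_card hsub
    _ ≤ _ := Finset.card_union_le _ _
    _ = _ := by rw [Finset.card_erase_of_mem hs]

theorem exists_labelling [DecidableEq W] (S : Finset W) (E : List ι) {e : ι → Finset W}
    (hE : ∀ a ∈ E, (e a).Nonempty) :
    ∃ κ : W → W, (∀ a ∈ E, ∀ x ∈ e a, ∀ y ∈ e a, κ x = κ y) ∧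
      S.card ≤ (S.image κ).card + (E.map fun a => (e a).card - 1).sum := by
  induction E with
  | nil => exact ⟨id, by simp, by simp⟩
  | cons a E ih =>
    obtain ⟨ha, hE⟩ := List.forall_mem_cons.1 hE
    obtain ⟨κ, hκ, hcard⟩ := ih hE
    obtain ⟨f, hf, hcard'⟩ := exists_merge (S.image κ) (ha.image κ)
    refine ⟨f ∘ κ, List.forall_mem_cons.2 ⟨fun x hx y hy => hf _ (Finset.mem_image_of_mem κ hx) _
      (Finset.mem_image_of_mem κ hy), fun b hb x hx y hy => congrArg f (hκ b hb x hx y hy)⟩, ?_⟩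
    rw [Finset.image_image] at hcard'
    have := Finset.card_image_le (s := e a) (f := κ)
    simp only [List.map_cons, List.sum_cons]
    omega

-- The bound on the edges leaves no room for a labelling that identifies two roots.
theorem exists_retraction {K : Type*} [Fintype K] [Nonempty K] {S : Finset W} {E : List ι}
    {e : ι → Finset W} {t : K → W} (hE : ∀ a ∈ E, (e a).Nonempty)
    (hcard : Fintype.card K + (E.map fun a => (e a).card - 1).sum ≤ S.card)
    (hroot : ∀ κ : W → W, (∀ a ∈ E, ∀ x ∈ e a, ∀ y ∈ e a, κ x = κ y) →
      ∀ x ∈ S, ∃ k, κ x = κ (t k)) :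
    ∃ (ρ : W → K) (c : ι → K), (∀ a ∈ E, ∀ x ∈ e a, ρ x = c a) ∧ ∀ k, ρ (t k) = k := by
  classical
  obtain ⟨κ, hκ, hS⟩ := exists_labelling S E hE
  have himage : S.image κ ⊆ Finset.univ.image (κ ∘ t) := fun y hy => by
    obtain ⟨x, hx, rfl⟩ := Finset.mem_image.1 hy
    obtain ⟨k, hk⟩ := hroot κ hκ x hx
    exact Finset.mem_image.2 ⟨k, Finset.mem_univ k, hk.symm⟩
  have hinj : Function.Injective (κ ∘ t) := by
    rw [← Set.injOn_univ, ← Finset.coe_univ, ← Finset.card_image_iff]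
    refine le_antisymm Finset.card_image_le ?_
    have := Finset.card_le_card himage
    rw [Finset.card_univ]
    omega
  have hleft := Function.leftInverse_invFun hinj
  have hconst : ∀ a, ∃ k, a ∈ E → ∀ x ∈ e a, Function.invFun (κ ∘ t) (κ x) = k := fun a => by
    by_cases ha : a ∈ E
    · obtain ⟨y, hy⟩ := hE a ha
      exact ⟨_, fun _ x hx => congrArg _ (hκ a ha x hx y hy)⟩
    · exact ⟨Classical.arbitrary K, fun h => (ha h).elim⟩
  choose c hc using hconst
  exact ⟨_, c, hc, hleft⟩

end Labelling

/-! ### Minimal factorizations of the cycle through a list -/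

section ListProd

variable {V : Type*} {L : List (Perm V)}

theorem prod_apply_eq_self {x : V} (h : ∀ σ ∈ L, σ x = x) : L.prod x = x :=
  Subgroup.list_prod_mem (MulAction.stabilizer (Perm V) x) h

theorem prod_apply_eq {W : Type*} {κ : V → W} (h : ∀ σ ∈ L, ∀ x, κ (σ x) = κ x) (x : V) :
    κ (L.prod x) = κ x := by
  induction L with
  | nil => rfl
  | cons σ L ih =>
    obtain ⟨hσ, hL⟩ := List.forall_mem_cons.1 h
    rw [List.prod_cons, Perm.mul_apply, hσ, ih hL]

theorem eq_of_prod_eq_formPerm [DecidableEq V] {W : Type*} {κ : V → W} {l : List V}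
    (hl : l.Nodup)
    (hprod : L.prod = l.formPerm) (h : ∀ σ ∈ L, ∀ x, κ (σ x) = κ x) {x y : V} (hx : x ∈ l)
    (hy : y ∈ l) : κ x = κ y :=
  eq_of_sameCycle (prod_apply_eq h) (hprod ▸ hl.isCycleOn_formPerm.2 hx hy)

-- Being on the cycle of `s` through `x` is invariant under all factors unless `w` is on it.
theorem sameCycle_of_prod_eq_formPerm {G : List (Perm V)} [DecidableEq V] {l : List V}
    (hl : l.Nodup) (hprod : G.prod = l.formPerm) {s : Perm V} {w x : V} (hw : w ∈ l) (hx : x ∈ l)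
    (hs : s x ≠ x) (h : ∀ τ ∈ G, τ ≠ s → ∀ y ≠ w, s y ≠ y → τ y = y) : s.SameCycle w x := by
  by_contra hcon
  refine hcon ((eq_of_prod_eq_formPerm (κ := s.SameCycle x) hl hprod (fun τ hτ y => ?_) hx
    hw).mp (.refl s x)).symm
  by_cases hτs : τ = s
  · rw [hτs, Perm.sameCycle_apply_right]
  · have hfix : ∀ y, s.SameCycle x y → τ y = y := fun y hy =>
      h τ hτ hτs y (fun hyw => hcon (hyw ▸ hy.symm)) (mt hy.apply_eq_self_iff.2 hs)
    by_cases hy : τ y = y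
    · rw [hy]
    · exact propext (iff_of_false (fun hy' => hy (τ.injective (hfix _ hy'))) (mt (hfix y) hy))

end ListProd

section Minimal

variable {V : Type*} [Fintype V] [DecidableEq V] {l : List V} {L L' : List (Perm V)}

/-- The sum of the numbers `j - 1` over the `j`-cycles in the list; a factorization is minimal when
this number is as small as the product permits. -/
def totalRank (L : List (Perm V)) : ℕ := (L.map fun σ => σ.support.card - 1).sum

theorem totalRank_append (L L' : List (Perm V)) :
    totalRank (L ++ L') = totalRank L + totalRank L' := by simp [totalRank]

theorem totalRank_cons (σ : Perm V) (L : List (Perm V)) :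
    totalRank (σ :: L) = (σ.support.card - 1) + totalRank L := by simp [totalRank]

theorem totalRank_flatten_ofFn {k : ℕ} (A : Fin k → List (Perm V)) :
    totalRank (List.ofFn A).flatten = ∑ i, totalRank (A i) := by
  induction k with
  | zero => simp [totalRank]
  | succ k ih =>
    rw [List.ofFn_succ, List.flatten_cons, totalRank_append, ih, Fin.sum_univ_succ]

theorem totalRank_eq_of_perm (h : L.Perm L') : totalRank L = totalRank L' :=
  (h.map _).sum_eq

theorem totalRank_revInv (L : List (Perm V)) : totalRank (revInv L) = totalRank L := by
  simp [totalRank, revInv, List.sum_reverse, Function.comp_def]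

theorem totalRank_eq_zero_iff (h : ∀ σ ∈ L, σ.IsCycle) : totalRank L = 0 ↔ L = [] := by
  refine ⟨fun h₀ => List.eq_nil_iff_forall_not_mem.2 fun σ hσ => ?_, by rintro rfl; rfl⟩
  have := List.sum_eq_zero_iff.1 h₀ _ (List.mem_map_of_mem hσ)
  have := (h σ hσ).two_le_card_support
  omega

theorem support_nonempty_of_isCycle {σ : Perm V} (h : σ.IsCycle) : σ.support.Nonempty :=
  Finset.card_pos.1 (zero_lt_two.trans_le h.two_le_card_support)

theorem apply_eq_of_forall_mem_support {W : Type*} {κ : V → W} {σ : Perm V}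
    (h : ∀ x ∈ σ.support, ∀ y ∈ σ.support, κ x = κ y) (x : V) : κ (σ x) = κ x := by
  by_cases hx : x ∈ σ.support
  · exact h _ (Perm.apply_mem_support.2 hx) _ hx
  · rw [Perm.notMem_support.1 hx]

theorem exists_mem_support_of_prod_apply_ne {x : V} (h : L.prod x ≠ x) :
    ∃ σ ∈ L, x ∈ σ.support := by
  by_contra! hfix
  exact h (prod_apply_eq_self fun σ hσ => Perm.notMem_support.1 (hfix σ hσ))

/-- `L` is a minimal factorization into cycles of the cycle through the entries of `l`. -/
structure MinFact (l : List V) (L : List (Perm V)) : Prop where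
  nodup : l.Nodup
  isCycle : ∀ σ ∈ L, σ.IsCycle
  mem_of_mem_support : ∀ σ ∈ L, ∀ x ∈ σ.support, x ∈ l
  prod_eq : L.prod = l.formPerm
  rank_eq : totalRank L + 1 = l.length

theorem length_le_totalRank_of_subset (hl : l.Nodup) (hL' : ∀ σ ∈ L', σ.IsCycle) (hsub : L ⊆ L')
    (hprod : L.prod = l.formPerm) : l.length ≤ totalRank L' + 1 := by
  obtain ⟨κ, hκ, hcard⟩ := exists_labelling l.toFinset L' (e := Perm.support)
    fun σ hσ => support_nonempty_of_isCycle (hL' σ hσ)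
  have hone : (l.toFinset.image κ).card ≤ 1 := by
    rw [Finset.card_le_one]
    simp only [Finset.mem_image, List.mem_toFinset]
    rintro _ ⟨x, hx, rfl⟩ _ ⟨y, hy, rfl⟩
    exact eq_of_prod_eq_formPerm hl hprod
      (fun σ hσ => apply_eq_of_forall_mem_support (hκ σ (hsub hσ))) hx hy
  rw [List.toFinset_card_of_nodup hl] at hcard
  exact hcard.trans (by rw [add_comm]; exact Nat.add_le_add_left hone _)

theorem length_le_totalRank (hl : l.Nodup) (hL : ∀ σ ∈ L, σ.IsCycle)
    (hprod : L.prod = l.formPerm) : l.length ≤ totalRank L + 1 :=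
  length_le_totalRank_of_subset hl hL (List.Subset.refl L) hprod

theorem minFact_singleton (a : V) : MinFact [a] [] where
  nodup := List.nodup_singleton a
  isCycle := by simp
  mem_of_mem_support := by simp
  prod_eq := by simp
  rank_eq := by simp [totalRank]

namespace MinFact

theorem append_comm {X Y : List V} (h : MinFact (X ++ Y) L) : MinFact (Y ++ X) L where
  nodup := List.nodup_append_comm.1 h.nodup
  isCycle := h.isCycle
  mem_of_mem_support σ hσ x hx :=
    List.perm_append_comm.mem_iff.1 (h.mem_of_mem_support σ hσ x hx)
  prod_eq := by rw [h.prod_eq, formPerm_append_comm h.nodup]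
  rank_eq := by rw [h.rank_eq, List.length_append, List.length_append, Nat.add_comm]

theorem revInv (h : MinFact l L) : MinFact l.reverse (CycleFactorization.revInv L) where
  nodup := List.nodup_reverse.2 h.nodup
  isCycle σ hσ := by simpa using (h.isCycle _ (mem_revInv.1 hσ)).inv
  mem_of_mem_support σ hσ x hx := List.mem_reverse.2 <|
    h.mem_of_mem_support _ (mem_revInv.1 hσ) x (by simpa using hx)
  prod_eq := by rw [prod_revInv, h.prod_eq, List.formPerm_reverse]
  rank_eq := by rw [totalRank_revInv, h.rank_eq, List.length_reverse]

theorem eq_nil_iff (h : MinFact l L) : L = [] ↔ l.length = 1 := by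
  rw [← totalRank_eq_zero_iff h.isCycle, ← h.rank_eq, Nat.add_eq_right]

theorem ne_nil (h : MinFact l L) : l ≠ [] := by
  rintro rfl
  simpa using h.rank_eq

theorem nodup_factors (h : MinFact l L) : L.Nodup := by
  obtain ⟨R, hR⟩ := (List.dedup_sublist L).exists_perm_append
  have hle := length_le_totalRank_of_subset (L' := L.dedup) h.nodup
    (fun σ hσ => h.isCycle σ (List.mem_dedup.1 hσ)) (fun σ hσ => List.mem_dedup.2 hσ) h.prod_eq
  have hrank := h.rank_eq
  rw [totalRank_eq_of_perm hR, totalRank_append] at hrank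
  have hnil : R = [] := (totalRank_eq_zero_iff fun σ hσ =>
    h.isCycle σ (hR.mem_iff.2 (List.mem_append_right _ hσ))).1 (by omega)
  rw [hnil, List.append_nil] at hR
  exact hR.nodup_iff.2 (List.nodup_dedup L)

theorem exists_mem_support (h : MinFact l L) (hL : L ≠ []) {x : V} (hx : x ∈ l) :
    ∃ σ ∈ L, x ∈ σ.support := by
  refine exists_mem_support_of_prod_apply_ne fun hfix => hL (h.eq_nil_iff.2 ?_)
  rw [h.prod_eq, List.formPerm_apply_mem_eq_self_iff _ h.nodup x hx] at hfix
  exact le_antisymm hfix (List.length_pos_iff.2 h.ne_nil)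

end MinFact

end Minimal

section Commute

variable {V : Type*} [Fintype V] [DecidableEq V] {σ τ : Perm V}

theorem commute_of_disjoint_support (h : ∀ x ∈ σ.support, x ∉ τ.support) : Commute σ τ :=
  (Perm.disjoint_iff_disjoint_support.2 (Finset.disjoint_left.2 h)).commute

theorem not_commute_of_unique_common {w : V} (hσ : w ∈ σ.support) (hτ : w ∈ τ.support)
    (h : ∀ x ∈ σ.support, x ∈ τ.support → x = w) : ¬Commute σ τ := by
  have hfix : ∀ {σ τ : Perm V}, w ∈ σ.support →
      (∀ x ∈ σ.support, x ∈ τ.support → x = w) → τ (σ w) = σ w := fun hσ h => by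
    by_contra hne
    exact Perm.mem_support.1 hσ (h _ (Perm.apply_mem_support.2 hσ) (Perm.mem_support.2 hne))
  intro hc
  have hστ : τ w = σ w := by
    rw [← hfix hτ fun x hx hx' => h x hx' hx, ← Perm.mul_apply, hc.eq, Perm.mul_apply,
      hfix hσ h]
  have hmem : σ w ∈ τ.support := hστ ▸ Perm.apply_mem_support.2 hτ
  exact Perm.mem_support.1 hσ (h _ (Perm.apply_mem_support.2 hσ) hmem)

end Commute

/-! ### Decomposition at the last factor that moves the first point -/

section Coloring

variable {V : Type*} [Fintype V] [DecidableEq V] {ι : Type*} {l : List V}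
  {A B : List (Perm V)} {P : Perm V} {w : ι → V}

/-- A colouring of the factors in a minimal factorization `A ++ P :: B`, where `P` is a cycle with
points `w i`. The colour `(i, false)` stands for the component of the points that hangs at `w i`
through factors in `A`, and `(i, true)` for the one that hangs at `w i` through factors in `B`;
`ρ` gives the component of the points off `P`. -/
structure IsColoring (A B : List (Perm V)) (w : ι → V) (ρ : V → ι × Bool)
    (c : Perm V → ι × Bool) : Prop where
  off : ∀ σ ∈ A ++ B, ∀ x ∈ σ.support, x ∉ Set.range w → ρ x = c σ
  left : ∀ σ ∈ A, ∀ i, w i ∈ σ.support → c σ = (i, false)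
  right : ∀ σ ∈ B, ∀ i, w i ∈ σ.support → c σ = (i, true)

-- A label that avoids the points of `P` would be carried around the whole cycle through `l`.
theorem exists_mem_support_label_eq {W : Type*} {κA κB : V → W} (hl : l.Nodup)
    (hprod : (A ++ P :: B).prod = l.formPerm) (hP : ∃ a ∈ P.support, a ∈ l)
    (hA : ∀ σ ∈ A, ∀ x ∈ σ.support, ∀ y ∈ σ.support, κA x = κA y)
    (hB : ∀ σ ∈ B, ∀ x ∈ σ.support, ∀ y ∈ σ.support, κB x = κB y)
    (hoff : ∀ x ∉ P.support, κA x = κB x) {x : V} (hx : x ∈ l) :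
    ∃ y ∈ P.support, κA x = κA y ∨ κA x = κB y := by
  by_contra! hcon
  have hB' : ∀ y, (κA y = κA x) = (κB y = κA x) := fun y => by
    by_cases hy : y ∈ P.support
    · exact propext (iff_of_false (hcon y hy).1.symm (hcon y hy).2.symm)
    · rw [hoff y hy]
  obtain ⟨a, haP, hal⟩ := hP
  refine (hcon a haP).1 ((eq_of_prod_eq_formPerm (κ := fun y => κA y = κA x) hl hprod
    (fun σ hσ y => ?_) hx hal).mp rfl).symm
  simp only [List.mem_append, List.mem_cons] at hσ
  obtain hσ | rfl | hσ := hσ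
  · simp only [apply_eq_of_forall_mem_support (hA σ hσ) y]
  · by_cases hy : y ∈ σ.support
    · exact propext (iff_of_false (hcon _ (Perm.apply_mem_support.2 hy)).1.symm
        (hcon y hy).1.symm)
    · rw [Perm.notMem_support.1 hy]
  · simp only [hB', apply_eq_of_forall_mem_support (hB σ hσ) y]

/-- The vertex at which a factor to the right of `P` sees the point `x`. The points of `P` occur
twice in `V ⊕ V`, so that cutting at `P` separates what hangs at them on either side. -/
def rightCopy (P : Perm V) (x : V) : V ⊕ V := if x ∈ P.support then .inr x else .inl x

theorem rightCopy_injective (P : Perm V) : Function.Injective (rightCopy P) := fun x y h => by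
  unfold rightCopy at h
  split_ifs at h <;> simp_all

/-- The vertices in `V ⊕ V` that are joined by the factor `σ`. -/
def cutEdge (A : List (Perm V)) (P σ : Perm V) : Finset (V ⊕ V) :=
  if σ ∈ A then σ.support.map ⟨.inl, Sum.inl_injective⟩
  else σ.support.map ⟨rightCopy P, rightCopy_injective P⟩

theorem inl_mem_cutEdge {σ : Perm V} (hσ : σ ∈ A) {x : V} (hx : x ∈ σ.support) :
    .inl x ∈ cutEdge A P σ := by
  rw [cutEdge, if_pos hσ]
  exact Finset.mem_map_of_mem _ hx

theorem rightCopy_mem_cutEdge {σ : Perm V} (hσ : σ ∉ A) {x : V} (hx : x ∈ σ.support) :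
    rightCopy P x ∈ cutEdge A P σ := by
  rw [cutEdge, if_neg hσ]
  exact Finset.mem_map_of_mem _ hx

theorem card_cutEdge (σ : Perm V) : (cutEdge A P σ).card = σ.support.card := by
  unfold cutEdge
  split_ifs <;> exact Finset.card_map _

/-- The vertex of `V ⊕ V` at which the component of colour `k` is rooted. -/
def cutRoot (w : ι → V) (k : ι × Bool) : V ⊕ V := if k.2 then .inr (w k.1) else .inl (w k.1)

theorem card_support_eq [Fintype ι] (hw : Function.Injective w)
    (hP : ∀ x, x ∈ P.support ↔ x ∈ Set.range w) : P.support.card = Fintype.card ι := by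
  rw [← Finset.card_univ, ← Finset.card_image_of_injective _ hw]
  congr 1
  ext x
  simp [hP]

theorem card_disjSum_support [Fintype ι] (h : MinFact l (A ++ P :: B))
    (hw : Function.Injective w) (hP : ∀ x, x ∈ P.support ↔ x ∈ Set.range w) :
    Fintype.card (ι × Bool) + totalRank (A ++ B) = (l.toFinset.disjSum P.support).card := by
  have hcard := card_support_eq hw hP
  have hpos : 2 ≤ P.support.card := (h.isCycle P (by simp)).two_le_card_support
  have hrank := h.rank_eq
  rw [totalRank_append, totalRank_cons] at hrank
  rw [Finset.card_disjSum, List.toFinset_card_of_nodup h.nodup, Fintype.card_prod,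
    Fintype.card_bool, totalRank_append]
  omega

theorem MinFact.exists_eq_cutRoot (h : MinFact l (A ++ P :: B))
    (hP : ∀ x, x ∈ P.support ↔ x ∈ Set.range w) (hAB : ∀ σ ∈ B, σ ∉ A) {κ : V ⊕ V → V ⊕ V}
    (hκ : ∀ σ ∈ A ++ B, ∀ x ∈ cutEdge A P σ, ∀ y ∈ cutEdge A P σ, κ x = κ y) :
    ∀ x ∈ l.toFinset.disjSum P.support, ∃ k, κ x = κ (cutRoot w k) := by
  intro x hx
  obtain ⟨x, hxl, rfl⟩ | ⟨x, hxP, rfl⟩ := Finset.mem_disjSum.1 hx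
  · obtain ⟨a, ha⟩ := support_nonempty_of_isCycle (h.isCycle P (by simp))
    obtain ⟨y, hy, hxy⟩ := exists_mem_support_label_eq (κA := fun x => κ (.inl x))
      (κB := fun x => κ (rightCopy P x)) h.nodup h.prod_eq
      ⟨a, ha, h.mem_of_mem_support P (by simp) a ha⟩
      (fun σ hσ x hx y hy => hκ σ (List.mem_append_left _ hσ) _ (inl_mem_cutEdge hσ hx) _
        (inl_mem_cutEdge hσ hy))
      (fun σ hσ x hx y hy => hκ σ (List.mem_append_right _ hσ) _
        (rightCopy_mem_cutEdge (hAB σ hσ) hx) _ (rightCopy_mem_cutEdge (hAB σ hσ) hy))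
      (fun x hx => congrArg κ (if_neg hx).symm) (List.mem_toFinset.1 hxl)
    obtain ⟨i, rfl⟩ := (hP y).1 hy
    exact hxy.elim (fun h => ⟨(i, false), h⟩) fun h => ⟨(i, true), h.trans (congrArg κ (if_pos hy))⟩
  · obtain ⟨i, rfl⟩ := (hP x).1 hxP
    exact ⟨(i, true), rfl⟩

theorem MinFact.exists_isColoring [Finite ι] [Nonempty ι] (h : MinFact l (A ++ P :: B))
    (hw : Function.Injective w) (hP : ∀ x, x ∈ P.support ↔ x ∈ Set.range w) :
    ∃ ρ c, IsColoring A B w ρ c := by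
  cases nonempty_fintype ι
  have hAB : ∀ σ ∈ B, σ ∉ A := fun σ hB hA =>
    (List.nodup_append.1 h.nodup_factors).2.2 σ hA σ (List.mem_cons_of_mem P hB) rfl
  have hne : ∀ σ ∈ A ++ B, (cutEdge A P σ).Nonempty := fun σ hσ => by
    rw [← Finset.card_pos, card_cutEdge, Finset.card_pos]
    exact support_nonempty_of_isCycle (h.isCycle σ (by grind))
  obtain ⟨ρ, c, hc, hρ⟩ := exists_retraction hne
    (by simp only [card_cutEdge]; exact (card_disjSum_support h hw hP).le)
    fun κ hκ => h.exists_eq_cutRoot hP hAB hκ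
  refine ⟨fun x => ρ (.inl x), c, fun σ hσ x hx hxw => ?_, fun σ hσ i hi => ?_,
    fun σ hσ i hi => ?_⟩
  · by_cases hσA : σ ∈ A
    · exact hc σ hσ _ (inl_mem_cutEdge hσA hx)
    · rw [← hc σ hσ _ (rightCopy_mem_cutEdge hσA hx), rightCopy, if_neg (mt (hP x).1 hxw)]
  · rw [← hc σ (List.mem_append_left _ hσ) _ (inl_mem_cutEdge hσ hi)]
    exact hρ (i, false)
  · rw [← hc σ (List.mem_append_right _ hσ) _ (rightCopy_mem_cutEdge (hAB σ hσ) hi), rightCopy,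
      if_pos ((hP _).2 ⟨i, rfl⟩)]
    exact hρ (i, true)

end Coloring

theorem nodup_flatten_ofFn {V : Type*} {k : ℕ} {w : Fin k → V} {ρ : V → Fin k × Bool}
    {X : Fin k × Bool → List V} (hw : Function.Injective w) (hX : ∀ i, (w i.1 :: X i).Nodup)
    (hρ : ∀ i, ∀ y ∈ X i, y ∉ Set.range w ∧ ρ y = i) :
    (List.ofFn fun i => X (i, false) ++ w i :: X (i, true)).flatten.Nodup := by
  have hmem : ∀ i, ∀ y ∈ X (i, false) ++ w i :: X (i, true),
      y = w i ∨ y ∉ Set.range w ∧ (ρ y).1 = i := fun i y hy => by grind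
  rw [List.nodup_flatten, List.pairwise_ofFn]
  refine ⟨List.forall_mem_ofFn_iff.2 fun i => ?_, fun i j hij y hyi hyj => ?_⟩
  · have h₁ := hX (i, false)
    have h₂ := hX (i, true)
    rw [List.nodup_append]
    grind
  · obtain hi | ⟨hy, hi⟩ := hmem i y hyi <;> obtain hj | ⟨hy', hj⟩ := hmem j y hyj
    · exact hij.ne (hw (hi.symm.trans hj))
    · exact hy' ⟨i, hi.symm⟩
    · exact hy ⟨j, hj.symm⟩
    · exact hij.ne (hi.symm.trans hj)

section Decomposition

variable {V : Type*} [Fintype V] [DecidableEq V] {ι : Type*} {l : List V}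
  {A B L : List (Perm V)} {P : Perm V}

namespace IsColoring

variable {w : ι → V} {ρ : V → ι × Bool} {c : Perm V → ι × Bool} {σ τ : Perm V} {i : ι}

theorem fst_eq (h : IsColoring A B w ρ c) (hσ : σ ∈ A ++ B) (hi : w i ∈ σ.support) :
    (c σ).1 = i := by
  obtain hσ | hσ := List.mem_append.1 hσ
  · rw [h.left σ hσ i hi]
  · rw [h.right σ hσ i hi]

theorem commute_of_ne (h : IsColoring A B w ρ c) (hσ : σ ∈ A ++ B) (hτ : τ ∈ A ++ B)
    (hne : c σ ≠ c τ) (hw : ∀ i, w i ∈ σ.support → w i ∉ τ.support) : Commute σ τ := by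
  refine commute_of_disjoint_support fun x hxσ hxτ => ?_
  by_cases hx : x ∈ Set.range w
  · obtain ⟨i, rfl⟩ := hx
    exact hw i hxσ hxτ
  · exact hne ((h.off σ hσ x hxσ hx).symm.trans (h.off τ hτ x hxτ hx))

theorem commute_of_fst_ne (h : IsColoring A B w ρ c) (hσ : σ ∈ A ++ B) (hτ : τ ∈ A ++ B)
    (hne : (c σ).1 ≠ (c τ).1) : Commute σ τ :=
  h.commute_of_ne hσ hτ (fun h => hne (congrArg Prod.fst h)) fun _ hi hi' =>
    hne ((h.fst_eq hσ hi).trans (h.fst_eq hτ hi').symm)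

theorem traceEquiv_filter_append_filter (h : IsColoring A B w ρ c) (hL : L ⊆ A ++ B)
    (hw : ∀ σ ∈ L, ∀ τ ∈ L, ∀ i, w i ∈ σ.support → w i ∈ τ.support → c σ = c τ) :
    TraceEquiv L (L.filter (fun σ => (c σ).2 = false) ++ L.filter (fun σ => (c σ).2 = true)) := by
  have hfilter := TraceEquiv.filter_append_filter_not (p := fun σ => (c σ).2 = false) (L := L) <|
    List.pairwise_of_forall_mem_list fun σ hσ τ hτ hcσ hcτ =>
      have hne : c σ ≠ c τ := fun heq => hcσ (heq ▸ hcτ)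
      h.commute_of_ne (hL hσ) (hL hτ) hne fun i hi hi' => hne (hw σ hσ τ hτ i hi hi')
  simpa only [Bool.not_eq_false] using hfilter

theorem traceEquiv_filter_snd (h : IsColoring A B w ρ c)
    (hP : ∀ x, x ∈ P.support ↔ x ∈ Set.range w) :
    TraceEquiv (A ++ P :: B) ((A ++ B).filter (fun σ => (c σ).2 = false) ++
      P :: (A ++ B).filter (fun σ => (c σ).2 = true)) := by
  let lft : List (Perm V) → List (Perm V) := List.filter fun σ => (c σ).2 = false
  let rgt : List (Perm V) → List (Perm V) := List.filter fun σ => (c σ).2 = true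
  have hA : ∀ σ ∈ rgt A, ∀ i, w i ∉ σ.support := fun σ hσ i hi => by
    simp [h.left σ (List.mem_of_mem_filter hσ) i hi, rgt] at hσ
  have hB : ∀ σ ∈ lft B, ∀ i, w i ∉ σ.support := fun σ hσ i hi => by
    simp [h.right σ (List.mem_of_mem_filter hσ) i hi, lft] at hσ
  have hcommP : ∀ σ : Perm V, (∀ i, w i ∉ σ.support) → Commute σ P := fun σ hσ =>
    commute_of_disjoint_support fun x hx hxP => by
      obtain ⟨i, rfl⟩ := (hP x).1 hxP
      exact hσ i hx
  have hcommAB : ∀ σ ∈ rgt A, ∀ τ ∈ lft B, Commute σ τ := fun σ hσ τ hτ =>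
    h.commute_of_ne (List.mem_append_left _ (List.mem_of_mem_filter hσ))
      (List.mem_append_right _ (List.mem_of_mem_filter hτ))
      (fun heq => by simp_all [lft, rgt]) fun i hi => (hA σ hσ i hi).elim
  calc TraceEquiv (A ++ P :: B) (lft A ++ rgt A ++ P :: (lft B ++ rgt B)) :=
        (h.traceEquiv_filter_append_filter (List.subset_append_left A B) fun σ hσ τ hτ i hi hi' =>
          (h.left σ hσ i hi).trans (h.left τ hτ i hi').symm).append <|
        (h.traceEquiv_filter_append_filter (List.subset_append_right A B) fun σ hσ τ hτ i hi hi' =>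
          (h.right σ hσ i hi).trans (h.right τ hτ i hi').symm).cons P
    _ = lft A ++ (rgt A ++ P :: lft B) ++ rgt B := by
        simp only [List.append_assoc, List.cons_append]
    TraceEquiv _ (lft A ++ (P :: lft B ++ rgt A) ++ rgt B) :=
        (TraceEquiv.append_left _ <| TraceEquiv.append_comm fun σ hσ =>
          List.forall_mem_cons.2 ⟨hcommP σ (hA σ hσ), hcommAB σ hσ⟩).append_right _
    _ = lft A ++ ([P] ++ lft B) ++ (rgt A ++ rgt B) := by simp
    TraceEquiv _ (lft A ++ (lft B ++ [P]) ++ (rgt A ++ rgt B)) :=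
        (TraceEquiv.append_left _ <| TraceEquiv.append_comm <|
          List.forall_mem_singleton.2 fun σ hσ => (hcommP σ (hB σ hσ)).symm).append_right _
    _ = _ := by simp [lft, rgt]

theorem exists_mem_of_prod_apply_ne [DecidableEq ι] (h : IsColoring A B w ρ c) {k : ι × Bool}
    {x : V} (hx : ((A ++ B).filter (c · = k)).prod x ≠ x) (hne : x ≠ w k.1) :
    x ∉ Set.range w ∧ ρ x = k := by
  obtain ⟨σ, hσ, hxσ⟩ := exists_mem_support_of_prod_apply_ne hx
  obtain ⟨hσ, hc⟩ := List.mem_filter.1 hσ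
  have hc : c σ = k := of_decide_eq_true hc
  have hxw : x ∉ Set.range w := by
    rintro ⟨i, rfl⟩
    exact hne (by rw [← hc, h.fst_eq hσ hxσ])
  exact ⟨hxw, by rw [h.off σ hσ x hxσ hxw, hc]⟩

theorem traceEquiv_flatten {k : ℕ} {w : Fin k → V} {ρ : V → Fin k × Bool}
    {c : Perm V → Fin k × Bool} (h : IsColoring A B w ρ c)
    (hP : ∀ x, x ∈ P.support ↔ x ∈ Set.range w) :
    TraceEquiv (A ++ P :: B)
      ((List.ofFn fun i => (A ++ B).filter (c · = (i, false))).flatten ++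
        P :: (List.ofFn fun i => (A ++ B).filter (c · = (i, true))).flatten) := by
  have hside : ∀ b, TraceEquiv ((A ++ B).filter fun σ => (c σ).2 = b)
      (List.ofFn fun i => (A ++ B).filter (c · = (i, b))).flatten := fun b => by
    have := TraceEquiv.flatten_filter_key (L := (A ++ B).filter fun σ => (c σ).2 = b)
      (key := fun σ => (c σ).1) (fun σ _ => (c σ).1.isLt) fun σ hσ τ hτ hne =>
        h.commute_of_fst_ne (List.mem_of_mem_filter hσ) (List.mem_of_mem_filter hτ)
          fun heq => hne (congrArg Fin.val heq)
    simpa only [List.filter_filter, Fin.val_inj, Prod.ext_iff, Bool.decide_and] using this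
  exact (h.traceEquiv_filter_snd hP).trans ((hside false).append ((hside true).cons P))

end IsColoring

/-- The points `X i` of colour `i`, in the order in which the product of the factors of colour `i`
visits them, starting from the point of `P` at which this colour hangs. -/
structure IsBlocks {k : ℕ} (A B : List (Perm V)) (w : Fin k → V) (ρ : V → Fin k × Bool)
    (c : Perm V → Fin k × Bool) (X : Fin k × Bool → List V) : Prop where
  prod_eq : ∀ i, ((A ++ B).filter (c · = i)).prod = (w i.1 :: X i).formPerm
  nodup : ∀ i, (w i.1 :: X i).Nodup
  off : ∀ i, ∀ x ∈ X i, x ∉ Set.range w ∧ ρ x = i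

namespace IsColoring

variable {k : ℕ} {w : Fin k → V} {ρ : V → Fin k × Bool} {c : Perm V → Fin k × Bool}

theorem exists_isBlocks (h : IsColoring A B w ρ c) (hL : MinFact l (A ++ P :: B))
    (hP : ∀ x, x ∈ P.support ↔ x ∈ Set.range w) : ∃ X, IsBlocks A B w ρ c X := by
  let s : Fin k × Bool → Perm V := fun i => ((A ++ B).filter (c · = i)).prod
  have hprod : ((List.ofFn fun i => s (i, false)) ++ P :: List.ofFn fun i => s (i, true)).prod =
      l.formPerm := by
    rw [← hL.prod_eq, (h.traceEquiv_flatten hP).prod_eq]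
    simp [List.prod_flatten, List.map_ofFn, Function.comp_def, s]
  have hfix : ∀ i, ∀ τ ∈ (List.ofFn fun i => s (i, false)) ++ P :: List.ofFn fun i => s (i, true),
      τ ≠ s i → ∀ y ≠ w i.1, s i y ≠ y → τ y = y := fun i τ hτ hne y hy hsy => by
    obtain ⟨hyw, hρ⟩ := h.exists_mem_of_prod_apply_ne hsy hy
    have hs : ∀ j, τ = s j → τ y = y := by
      rintro j rfl
      by_contra hmove
      exact hne (congrArg s ((h.exists_mem_of_prod_apply_ne hmove
        fun heq => hyw ⟨j.1, heq.symm⟩).2.symm.trans hρ))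
    simp only [List.mem_append, List.mem_cons, List.mem_ofFn] at hτ
    obtain ⟨j, hj⟩ | rfl | ⟨j, hj⟩ := hτ
    exacts [hs _ hj.symm, Perm.notMem_support.1 (mt (hP y).1 hyw), hs _ hj.symm]
  have hmem : ∀ i x, s i x ≠ x → x ∈ l := fun i x hx => by
    obtain ⟨σ, hσ, hxσ⟩ := exists_mem_support_of_prod_apply_ne hx
    exact hL.mem_of_mem_support σ (by have := List.mem_of_mem_filter hσ; grind) x hxσ
  have hblock : ∀ i, ∃ X, s i = (w i.1 :: X).formPerm ∧ (w i.1 :: X).Nodup ∧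
      ∀ x, x ∈ w i.1 :: X ↔ (s i).SameCycle (w i.1) x := fun i =>
    exists_eq_formPerm_cons fun x => Not.imp_symm fun hx =>
      sameCycle_of_prod_eq_formPerm hL.nodup hprod
        (hL.mem_of_mem_support P (by simp) _ ((hP _).2 ⟨i.1, rfl⟩)) (hmem i x hx) hx (hfix i)
  choose X hX hnodup hsame using hblock
  refine ⟨X, hX, hnodup, fun i x hx => ?_⟩
  have hxw : x ≠ w i.1 := fun heq => (List.nodup_cons.1 (hnodup i)).1 (heq ▸ hx)
  have hcyc := (hsame i x).1 (List.mem_cons_of_mem _ hx)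
  exact h.exists_mem_of_prod_apply_ne (fun hfix => hxw (hcyc.symm.eq_of_left hfix)) hxw

end IsColoring

section Blocks

variable {m : ℕ} {t : List V} {w : Fin (m + 1) → V} {ρ : V → Fin (m + 1) × Bool}
  {c : Perm V → Fin (m + 1) × Bool} {X : Fin (m + 1) × Bool → List V}

theorem IsBlocks.zero_false_eq_nil (h : IsBlocks A B w ρ c X) (hc : IsColoring A B w ρ c)
    (hA : ∀ σ ∈ A, w 0 ∉ σ.support) : X (0, false) = [] := by
  have hfix : ((A ++ B).filter (c · = (0, false))).prod (w 0) = w 0 :=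
    prod_apply_eq_self fun σ hσ => Perm.notMem_support.1 fun hσw => by
      obtain ⟨hσ, hcσ⟩ := List.mem_filter.1 hσ
      obtain hσ | hσ := List.mem_append.1 hσ
      · exact hA σ hσ hσw
      · simp [hc.right σ hσ 0 hσw] at hcσ
  rw [h.prod_eq, List.formPerm_apply_mem_eq_self_iff _ (h.nodup _) _ List.mem_cons_self] at hfix
  exact List.length_eq_zero_iff.1 (by simpa using hfix)

theorem IsBlocks.eq_flatten (h : IsBlocks A B w ρ c X) (hc : IsColoring A B w ρ c)
    (hL : MinFact (w 0 :: t) (A ++ P :: B)) (hw : Function.Injective w)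
    (hwP : (List.ofFn w).formPerm = P) (hP : ∀ x, x ∈ P.support ↔ x ∈ Set.range w)
    (hA : ∀ σ ∈ A, w 0 ∉ σ.support) :
    w 0 :: t = (List.ofFn fun i => X (i, false) ++ w i :: X (i, true)).flatten := by
  have h₀ := h.zero_false_eq_nil hc hA
  have hnodup := nodup_flatten_ofFn hw h.nodup h.off
  have hcomm : ∀ i, (w i :: X (i, false)).formPerm = (X (i, false) ++ [w i]).formPerm := fun i =>
    formPerm_append_comm (X := [w i]) (h.nodup (i, false))
  have hprod : (w 0 :: t).formPerm =
      (List.ofFn fun i => X (i, false) ++ w i :: X (i, true)).flatten.formPerm := by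
    rw [formPerm_flatten_ofFn (α := fun i => X (i, false)) h₀ hnodup, ← hL.prod_eq,
      (hc.traceEquiv_flatten hP).prod_eq, hwP]
    simp only [List.prod_append, List.prod_cons, List.prod_flatten, List.map_ofFn,
      Function.comp_def, h.prod_eq, hcomm, mul_assoc]
  rw [List.ofFn_succ, List.flatten_cons, h₀] at hnodup hprod ⊢
  exact congrArg (w 0 :: ·) (eq_of_formPerm_eq_of_head hL.nodup hnodup hprod)

theorem IsBlocks.length_eq (h : IsBlocks A B w ρ c X) (hc : IsColoring A B w ρ c)
    (hL : MinFact l (A ++ P :: B)) (hw : Function.Injective w)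
    (hP : ∀ x, x ∈ P.support ↔ x ∈ Set.range w)
    (hl : l = (List.ofFn fun i => X (i, false) ++ w i :: X (i, true)).flatten)
    (i : Fin (m + 1) × Bool) : (X i).length = totalRank ((A ++ B).filter (c · = i)) := by
  have hle : ∀ j, (X j).length ≤ totalRank ((A ++ B).filter (c · = j)) := fun j =>
    Nat.succ_le_succ_iff.1 <| length_le_totalRank (h.nodup j)
      (fun σ hσ => hL.isCycle σ (by have := List.mem_of_mem_filter hσ; grind)) (h.prod_eq j)
  have hrank := hL.rank_eq
  rw [totalRank_eq_of_perm (hc.traceEquiv_flatten hP).perm, totalRank_append, totalRank_cons,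
    totalRank_flatten_ofFn, totalRank_flatten_ofFn, card_support_eq hw hP, hl] at hrank
  have hsum : ∑ j, (X j).length = ∑ j, totalRank ((A ++ B).filter (c · = j)) := by
    simp only [List.length_flatten, List.map_ofFn, List.sum_ofFn, Function.comp_def,
      List.length_append, List.length_cons, Finset.sum_add_distrib, Finset.sum_const,
      Finset.card_univ, Fintype.card_fin, smul_eq_mul, mul_one] at hrank
    simp only [Fintype.sum_prod_type, Fintype.sum_bool, Finset.sum_add_distrib]
    omega
  exact (Finset.sum_eq_sum_iff_of_le fun j _ => hle j).1 hsum i (Finset.mem_univ i)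

theorem IsBlocks.minFact (h : IsBlocks A B w ρ c X) (hc : IsColoring A B w ρ c)
    (hL : MinFact l (A ++ P :: B)) (hw : Function.Injective w)
    (hP : ∀ x, x ∈ P.support ↔ x ∈ Set.range w)
    (hl : l = (List.ofFn fun i => X (i, false) ++ w i :: X (i, true)).flatten)
    (i : Fin (m + 1) × Bool) : MinFact (w i.1 :: X i) ((A ++ B).filter (c · = i)) where
  nodup := h.nodup i
  isCycle σ hσ := hL.isCycle σ (by have := List.mem_of_mem_filter hσ; grind)
  mem_of_mem_support σ hσ y hy := by
    obtain ⟨hσ, hcσ⟩ := List.mem_filter.1 hσ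
    have hcσ : c σ = i := of_decide_eq_true hcσ
    by_cases hyw : y ∈ Set.range w
    · obtain ⟨j, rfl⟩ := hyw
      rw [← hcσ, hc.fst_eq hσ hy]
      exact List.mem_cons_self
    · have hyl : y ∈ l := hL.mem_of_mem_support σ (by grind) y hy
      obtain ⟨j, b, hj⟩ : ∃ j b, y ∈ X (j, b) := by
        simp only [hl, List.mem_flatten, List.mem_ofFn', Set.mem_range] at hyl
        grind
      have : (j, b) = i := (h.off _ y hj).2.symm.trans ((hc.off σ hσ y hy hyw).trans hcσ)
      exact List.mem_cons_of_mem _ (this ▸ hj)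
  prod_eq := h.prod_eq i
  rank_eq := by rw [List.length_cons, h.length_eq hc hL hw hP hl]

end Blocks

/-- A factorization `L` of the cycle through `l = … αᵢ wᵢ βᵢ …` that consists of the cycle
`(w₀ w₁ …)`, of factorizations `A i` of the cycles through `αᵢ wᵢ` to the left of it, and of
factorizations `B i` of the cycles through `wᵢ βᵢ` to the right of it. -/
structure Decomp {m : ℕ} (α β : Fin (m + 2) → List V) (w : Fin (m + 2) → V)
    (A B : Fin (m + 2) → List (Perm V)) (l : List V) (L : List (Perm V)) : Prop where
  nodup : l.Nodup
  list_eq : l = (List.ofFn fun i => α i ++ w i :: β i).flatten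
  fact_eq : L = (List.ofFn A).flatten ++ (List.ofFn w).formPerm :: (List.ofFn B).flatten
  left : ∀ i, MinFact (α i ++ [w i]) (A i)
  right : ∀ i, MinFact (w i :: β i) (B i)
  first : α 0 = []

theorem exists_eq_formPerm_ofFn {a : V} (hP : P.IsCycle) (ha : a ∈ P.support) :
    ∃ (m : ℕ) (w : Fin (m + 2) → V), w 0 = a ∧ Function.Injective w ∧
      (∀ x, x ∈ P.support ↔ x ∈ Set.range w) ∧ (List.ofFn w).formPerm = P := by
  obtain ⟨m, hm⟩ := Nat.exists_eq_add_of_le' hP.two_le_card_support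
  have hc : P.cycleOf a = P := hP.cycleOf_eq (Perm.mem_support.1 ha)
  have hlist : List.ofFn (fun i : Fin (m + 2) => (P ^ i.val) a) = P.toList a :=
    List.ext_getElem (by simp [hc, hm]) fun i _ _ => by rw [Perm.getElem_toList, List.getElem_ofFn]
  refine ⟨m, fun i => (P ^ i.val) a, by simp, ?_, fun x => ?_, ?_⟩
  · rw [← List.nodup_ofFn, hlist]
    exact Perm.nodup_toList P a
  · rw [← List.mem_ofFn', hlist, Perm.mem_toList_iff, and_iff_left ha]
    exact ⟨fun hx => hP.sameCycle (Perm.mem_support.1 ha) (Perm.mem_support.1 hx),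
      fun hx => hx.mem_support_iff.1 ha⟩
  · rw [hlist, Perm.formPerm_toList, hc]

-- The factorization is cut at the leftmost factor that moves the head of `l`.
theorem MinFact.exists_decomp (h : MinFact l L) (hL : L ≠ []) :
    ∃ (m : ℕ) (α β : Fin (m + 2) → List V) (w : Fin (m + 2) → V)
      (A B : Fin (m + 2) → List (Perm V)) (L' : List (Perm V)),
      TraceEquiv L L' ∧ Decomp α β w A B l L' := by
  obtain ⟨a, t, rfl⟩ := List.exists_cons_of_ne_nil h.ne_nil
  obtain ⟨P, hfind⟩ : ∃ P, L.find? (fun σ => a ∈ σ.support) = some P := by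
    simpa [List.find?_isSome, ← Option.isSome_iff_exists] using
      h.exists_mem_support hL (x := a) List.mem_cons_self
  obtain ⟨haP, A, B, rfl, hA⟩ := List.find?_eq_some_iff_append.1 hfind
  obtain ⟨m, w, rfl, hw, hP, hwP⟩ :=
    exists_eq_formPerm_ofFn (h.isCycle P (by simp)) (of_decide_eq_true haP)
  have hA : ∀ σ ∈ A, w 0 ∉ σ.support := by simpa using hA
  obtain ⟨ρ, c, hc⟩ := h.exists_isColoring hw hP
  obtain ⟨X, hX⟩ := hc.exists_isBlocks h hP
  have hl := hX.eq_flatten hc h hw hwP hP hA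
  have hfact := hX.minFact hc h hw hP hl
  exact ⟨m, _, _, w, _, _, _, hc.traceEquiv_flatten hP, h.nodup, hl, by rw [hwP],
    fun i => (hfact (i, false)).append_comm (X := [w i]), fun i => hfact (i, true),
    hX.zero_false_eq_nil hc hA⟩

end Decomposition

section ListLemmas

variable {V : Type*}

theorem mem_flatten_ofFn {k : ℕ} {f : Fin k → List V} {x : V} :
    x ∈ (List.ofFn f).flatten ↔ ∃ i, x ∈ f i := by
  simp only [List.mem_flatten, List.mem_ofFn, exists_exists_eq_and]

theorem sublist_flatten_ofFn {k : ℕ} (f : Fin k → List V) (i : Fin k) :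
    (f i).Sublist (List.ofFn f).flatten :=
  List.sublist_flatten_of_mem (List.mem_ofFn.2 ⟨i, rfl⟩)

theorem eq_of_mem_of_nodup_flatten_ofFn {k : ℕ} {f : Fin k → List V}
    (h : (List.ofFn f).flatten.Nodup) {i j : Fin k} {x : V} (hi : x ∈ f i) (hj : x ∈ f j) :
    i = j := by
  have hp := List.pairwise_ofFn.1 (List.nodup_flatten.1 h).2
  obtain hij | hij | hij := lt_trichotomy i j
  exacts [(hp hij hi hj).elim, hij, (hp hij hj hi).elim]

theorem eq_filter_of_sublist [DecidableEq V] {X Y : List V} (h : X.Sublist Y) (hY : Y.Nodup) :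
    X = Y.filter (· ∈ X) := by
  have hsub := h.filter (· ∈ X)
  rw [List.filter_eq_self.2 fun x hx => decide_eq_true hx] at hsub
  exact hsub.eq_of_length_le ((hY.filter _).subperm fun x hx =>
    of_decide_eq_true (List.mem_filter.1 hx).2).length_le

theorem isHead_flatten_ofFn {M : Type*} [Monoid M] {k : ℕ} {f : Fin k → List M} {a : M}
    (h : ∀ {i j}, i ≠ j → ∀ b ∈ f i, ∀ c ∈ f j, Commute b c) :
    IsHead (List.ofFn f).flatten a ↔ ∃ i, IsHead (f i) a :=
  (isHead_flatten (List.pairwise_ofFn.2 fun _ _ hij => h hij.ne)).trans (by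
    simp only [List.mem_ofFn, exists_exists_eq_and])

theorem isTail_flatten_ofFn {M : Type*} [Monoid M] {k : ℕ} {f : Fin k → List M} {a : M}
    (h : ∀ {i j}, i ≠ j → ∀ b ∈ f i, ∀ c ∈ f j, Commute b c) :
    IsTail (List.ofFn f).flatten a ↔ ∃ i, IsTail (f i) a :=
  (isTail_flatten (List.pairwise_ofFn.2 fun _ _ hij => h hij.ne)).trans (by
    simp only [List.mem_ofFn, exists_exists_eq_and])

end ListLemmas

section DecompLemmas

variable {V : Type*} [Fintype V] [DecidableEq V]

namespace Decomp

variable {m : ℕ} {α β : Fin (m + 2) → List V} {w : Fin (m + 2) → V}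
  {A B : Fin (m + 2) → List (Perm V)} {l : List V} {L : List (Perm V)}
  {i j : Fin (m + 2)} {x : V} {σ τ : Perm V}

theorem nodup_flatten (h : Decomp α β w A B l L) :
    (List.ofFn fun i => α i ++ w i :: β i).flatten.Nodup :=
  h.list_eq ▸ h.nodup

theorem block_unique (h : Decomp α β w A B l L)
    (hi : x ∈ α i ++ w i :: β i) (hj : x ∈ α j ++ w j :: β j) : i = j :=
  eq_of_mem_of_nodup_flatten_ofFn h.nodup_flatten hi hj

theorem block_nodup (h : Decomp α β w A B l L) (i : Fin (m + 2)) : (α i ++ w i :: β i).Nodup :=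
  h.nodup_flatten.sublist (sublist_flatten_ofFn (fun i => α i ++ w i :: β i) i)

theorem injective (h : Decomp α β w A B l L) : Function.Injective w := fun i j hij =>
  h.block_unique (x := w i) (i := i) (j := j) (by simp) (by simp [hij])

theorem mem_block_of_left (h : Decomp α β w A B l L)
    (hσ : σ ∈ A i) (hx : x ∈ σ.support) : x ∈ α i ++ w i :: β i := by
  have := (h.left i).mem_of_mem_support σ hσ x hx
  simp only [List.mem_append, List.mem_cons] at this ⊢
  tauto

theorem mem_block_of_right (h : Decomp α β w A B l L)
    (hσ : σ ∈ B i) (hx : x ∈ σ.support) : x ∈ α i ++ w i :: β i := by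
  have := (h.right i).mem_of_mem_support σ hσ x hx
  simp only [List.mem_append, List.mem_cons] at this ⊢
  tauto

theorem mem_list_of_block (h : Decomp α β w A B l L) (hx : x ∈ α i ++ w i :: β i) : x ∈ l := by
  rw [h.list_eq]
  exact mem_flatten_ofFn.2 ⟨i, hx⟩

theorem eq_w_of_mem (h : Decomp α β w A B l L)
    (hi : x ∈ α i ++ [w i]) (hj : x ∈ w j :: β j) : i = j ∧ x = w i := by
  have hij : i = j := by
    refine h.block_unique (x := x) ?_ ?_
    · simp only [List.mem_append, List.mem_cons] at hi ⊢
      tauto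
    · simp only [List.mem_append, List.mem_cons] at hj ⊢
      tauto
  subst hij
  refine ⟨rfl, ?_⟩
  have hd := List.disjoint_of_nodup_append (h.block_nodup i)
  rw [List.mem_append, List.mem_singleton] at hi
  exact hi.resolve_left fun hx => hd hx hj

theorem nodup_ofFn (h : Decomp α β w A B l L) : (List.ofFn w).Nodup :=
  List.nodup_ofFn.2 h.injective

theorem isCycle (h : Decomp α β w A B l L) : (List.ofFn w).formPerm.IsCycle :=
  List.isCycle_formPerm h.nodup_ofFn (by simp)

theorem mem_support (h : Decomp α β w A B l L) :
    x ∈ (List.ofFn w).formPerm.support ↔ ∃ i, w i = x := by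
  rw [List.support_formPerm_of_nodup _ h.nodup_ofFn, List.mem_toFinset, List.mem_ofFn]
  intro y hy
  simpa using congrArg List.length hy

theorem card_support (h : Decomp α β w A B l L) : (List.ofFn w).formPerm.support.card = m + 2 := by
  rw [List.support_formPerm_of_nodup _ h.nodup_ofFn, List.toFinset_card_of_nodup h.nodup_ofFn,
    List.length_ofFn]
  intro y hy
  simpa using congrArg List.length hy

theorem mem_fact (h : Decomp α β w A B l L) :
    σ ∈ L ↔ (∃ i, σ ∈ A i) ∨ σ = (List.ofFn w).formPerm ∨ ∃ i, σ ∈ B i := by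
  rw [h.fact_eq, List.mem_append, List.mem_cons, mem_flatten_ofFn, mem_flatten_ofFn]

theorem two_le_left (h : Decomp α β w A B l L) (hσ : σ ∈ A i) : 2 ≤ σ.support.card :=
  ((h.left i).isCycle σ hσ).two_le_card_support

theorem two_le_right (h : Decomp α β w A B l L) (hσ : σ ∈ B i) : 2 ≤ σ.support.card :=
  ((h.right i).isCycle σ hσ).two_le_card_support

theorem left_unique (h : Decomp α β w A B l L) (hi : σ ∈ A i) (hj : σ ∈ A j) : i = j := by
  obtain ⟨x, hx⟩ := Finset.card_pos.1 (by have := h.two_le_left hi; omega : 0 < σ.support.card)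
  exact h.block_unique (h.mem_block_of_left hi hx) (h.mem_block_of_left hj hx)

theorem right_unique (h : Decomp α β w A B l L) (hi : σ ∈ B i) (hj : σ ∈ B j) : i = j := by
  obtain ⟨x, hx⟩ := Finset.card_pos.1 (by have := h.two_le_right hi; omega : 0 < σ.support.card)
  exact h.block_unique (h.mem_block_of_right hi hx) (h.mem_block_of_right hj hx)

theorem not_left_and_right (h : Decomp α β w A B l L) (hi : σ ∈ A i) (hj : σ ∈ B j) : False := by
  obtain ⟨x, hx, hne⟩ := Finset.exists_mem_ne (h.two_le_left hi) (w i)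
  exact hne (h.eq_w_of_mem ((h.left i).mem_of_mem_support σ hi x hx)
    ((h.right j).mem_of_mem_support σ hj x hx)).2

theorem not_subset_block (h : Decomp α β w A B l L) (i : Fin (m + 2)) :
    ¬ ∀ x ∈ (List.ofFn w).formPerm.support, x ∈ α i ++ w i :: β i := by
  intro hsub
  have h₁ := fun j => h.block_unique (hsub (w j) (h.mem_support.2 ⟨j, rfl⟩))
    (by simp : w j ∈ α j ++ w j :: β j)
  exact absurd ((h₁ 0).symm.trans (h₁ 1)) (by simp)

theorem ne_of_left (h : Decomp α β w A B l L) (hσ : σ ∈ A i) : σ ≠ (List.ofFn w).formPerm := by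
  rintro rfl
  exact h.not_subset_block i fun x hx => h.mem_block_of_left hσ hx

theorem ne_of_right (h : Decomp α β w A B l L) (hσ : σ ∈ B i) : σ ≠ (List.ofFn w).formPerm := by
  rintro rfl
  exact h.not_subset_block i fun x hx => h.mem_block_of_right hσ hx

theorem prod_eq (h : Decomp α β w A B l L) : L.prod = l.formPerm := by
  rw [h.list_eq, formPerm_flatten_ofFn h.first h.nodup_flatten, h.fact_eq]
  simp only [List.prod_append, List.prod_cons, List.prod_flatten, List.map_ofFn,
    Function.comp_def, (h.left _).prod_eq, (h.right _).prod_eq, mul_assoc]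

theorem minFact (h : Decomp α β w A B l L) : MinFact l L where
  nodup := h.nodup
  isCycle σ hσ := by
    rcases h.mem_fact.1 hσ with ⟨i, hi⟩ | rfl | ⟨i, hi⟩
    · exact (h.left i).isCycle σ hi
    · exact h.isCycle
    · exact (h.right i).isCycle σ hi
  mem_of_mem_support σ hσ x hx := by
    rcases h.mem_fact.1 hσ with ⟨i, hi⟩ | rfl | ⟨i, hi⟩
    · exact h.mem_list_of_block (h.mem_block_of_left hi hx)
    · obtain ⟨i, rfl⟩ := h.mem_support.1 hx
      exact h.mem_list_of_block (i := i) (by simp)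
    · exact h.mem_list_of_block (h.mem_block_of_right hi hx)
  prod_eq := h.prod_eq
  rank_eq := by
    have h₁ : ∀ i, totalRank (A i) = (α i).length := fun i => by
      simpa using (h.left i).rank_eq
    have h₂ : ∀ i, totalRank (B i) = (β i).length := fun i => by
      simpa using (h.right i).rank_eq
    have hlen := congrArg List.length h.list_eq
    simp only [List.length_flatten, List.map_ofFn, List.sum_ofFn, Function.comp_def,
      List.length_append, List.length_cons, Finset.sum_add_distrib, Finset.sum_const,
      Finset.card_univ, Fintype.card_fin, smul_eq_mul, mul_one] at hlen
    rw [h.fact_eq, totalRank_append, totalRank_cons, totalRank_flatten_ofFn,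
      totalRank_flatten_ofFn, h.card_support]
    simp only [h₁, h₂]
    omega

theorem commute_of_block_ne (h : Decomp α β w A B l L)
    (hij : i ≠ j) (hσ : ∀ x ∈ σ.support, x ∈ α i ++ w i :: β i)
    (hτ : ∀ x ∈ τ.support, x ∈ α j ++ w j :: β j) : Commute σ τ :=
  commute_of_disjoint_support fun x hx hx' => hij (h.block_unique (hσ x hx) (hτ x hx'))

theorem commute_left (h : Decomp α β w A B l L)
    (hij : i ≠ j) (hσ : σ ∈ A i) (hτ : τ ∈ A j) : Commute σ τ :=
  h.commute_of_block_ne hij (fun _ => h.mem_block_of_left hσ) fun _ => h.mem_block_of_left hτ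

theorem commute_right (h : Decomp α β w A B l L)
    (hij : i ≠ j) (hσ : σ ∈ B i) (hτ : τ ∈ B j) : Commute σ τ :=
  h.commute_of_block_ne hij (fun _ => h.mem_block_of_right hσ) fun _ => h.mem_block_of_right hτ

theorem commute_iff (h : Decomp α β w A B l L) (hσ : ∀ x ∈ σ.support, x ∈ α i ++ w i :: β i) :
    Commute (List.ofFn w).formPerm σ ↔ w i ∉ σ.support := by
  have key : ∀ x ∈ (List.ofFn w).formPerm.support, x ∈ σ.support → x = w i := by
    intro x hx hxσ
    obtain ⟨j, rfl⟩ := h.mem_support.1 hx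
    rw [h.block_unique (hσ _ hxσ) (by simp : w j ∈ α j ++ w j :: β j)]
  refine ⟨fun hc hw => ?_, fun hw => ?_⟩
  · exact not_commute_of_unique_common (h.mem_support.2 ⟨i, rfl⟩) hw key hc
  · refine commute_of_disjoint_support fun x hx hxσ => hw ?_
    rwa [← key x hx hxσ]

theorem commute_left_right (h : Decomp α β w A B l L) (hσ : σ ∈ A i) (hτ : τ ∈ B j)
    (hw : w i ∉ σ.support ∨ w j ∉ τ.support) : Commute σ τ := by
  refine commute_of_disjoint_support fun x hx hx' => ?_
  obtain ⟨rfl, rfl⟩ := h.eq_w_of_mem ((h.left i).mem_of_mem_support σ hσ x hx)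
    ((h.right j).mem_of_mem_support τ hτ x hx')
  tauto

theorem isHead_iff (h : Decomp α β w A B l L) : IsHead L σ ↔ IsHead (List.ofFn A).flatten σ ∨
    ((∀ τ ∈ (List.ofFn A).flatten, Commute τ σ) ∧ ((List.ofFn w).formPerm = σ ∨
      (Commute (List.ofFn w).formPerm σ ∧ IsHead (List.ofFn B).flatten σ))) := by
  rw [h.fact_eq, isHead_append]; rfl

theorem isTail_iff (h : Decomp α β w A B l L) : IsTail L σ ↔ (IsTail (List.ofFn B).flatten σ ∨
    ((∀ τ ∈ (List.ofFn B).flatten, Commute τ σ) ∧ (List.ofFn w).formPerm = σ)) ∨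
    (((∀ τ ∈ (List.ofFn B).flatten, Commute τ σ) ∧ Commute (List.ofFn w).formPerm σ) ∧
      IsTail (List.ofFn A).flatten σ) := by
  rw [h.fact_eq, isTail_append, isTail_cons, List.forall_mem_cons]
  tauto

theorem isHead_left_iff (h : Decomp α β w A B l L) :
    IsHead (List.ofFn A).flatten σ ↔ ∃ i, IsHead (A i) σ :=
  isHead_flatten_ofFn fun hij _ hσ _ hτ => h.commute_left hij hσ hτ

theorem isHead_right_iff (h : Decomp α β w A B l L) :
    IsHead (List.ofFn B).flatten σ ↔ ∃ i, IsHead (B i) σ :=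
  isHead_flatten_ofFn fun hij _ hσ _ hτ => h.commute_right hij hσ hτ

theorem isTail_left_iff (h : Decomp α β w A B l L) :
    IsTail (List.ofFn A).flatten σ ↔ ∃ i, IsTail (A i) σ :=
  isTail_flatten_ofFn fun hij _ hσ _ hτ => h.commute_left hij hσ hτ

theorem isTail_right_iff (h : Decomp α β w A B l L) :
    IsTail (List.ofFn B).flatten σ ↔ ∃ i, IsTail (B i) σ :=
  isTail_flatten_ofFn fun hij _ hσ _ hτ => h.commute_right hij hσ hτ

theorem isHead_of_mem_left (h : Decomp α β w A B l L)
    (hσ : σ ∈ A i) : IsHead L σ ↔ IsHead (A i) σ := by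
  rw [h.isHead_iff, h.isHead_left_iff, h.isHead_right_iff]
  constructor
  · rintro (⟨j, hj⟩ | ⟨_, rfl | ⟨_, j, hj⟩⟩)
    · rwa [h.left_unique hσ hj.mem]
    · exact (h.ne_of_left hσ rfl).elim
    · exact (h.not_left_and_right hσ hj.mem).elim
  · exact fun hc => Or.inl ⟨i, hc⟩

theorem isTail_of_mem_right (h : Decomp α β w A B l L)
    (hσ : σ ∈ B i) : IsTail L σ ↔ IsTail (B i) σ := by
  rw [h.isTail_iff, h.isTail_left_iff, h.isTail_right_iff]
  constructor
  · rintro ((⟨j, hj⟩ | ⟨_, rfl⟩) | ⟨_, j, hj⟩)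
    · rwa [h.right_unique hσ hj.mem]
    · exact (h.ne_of_right hσ rfl).elim
    · exact (h.not_left_and_right hj.mem hσ).elim
  · exact fun hc => Or.inl (Or.inl ⟨i, hc⟩)

theorem isTail_of_mem_left (h : Decomp α β w A B l L) (hσ : σ ∈ A i) :
    IsTail L σ ↔ IsTail (A i) σ ∧ w i ∉ σ.support := by
  rw [h.isTail_iff, h.isTail_left_iff, h.isTail_right_iff,
    h.commute_iff fun x => h.mem_block_of_left hσ]
  constructor
  · rintro ((⟨j, hj⟩ | ⟨_, rfl⟩) | ⟨⟨_, hc⟩, j, hj⟩)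
    · exact (h.not_left_and_right hσ hj.mem).elim
    · exact (h.ne_of_left hσ rfl).elim
    · rw [h.left_unique hσ hj.mem] at *
      exact ⟨hj, hc⟩
  · rintro ⟨hc, hw⟩
    refine Or.inr ⟨⟨fun τ hτ => ?_, hw⟩, i, hc⟩
    obtain ⟨j, hj⟩ := mem_flatten_ofFn.1 hτ
    exact (h.commute_left_right hσ hj (Or.inl hw)).symm

theorem isHead_of_mem_right (h : Decomp α β w A B l L) (hσ : σ ∈ B i) :
    IsHead L σ ↔ IsHead (B i) σ ∧ w i ∉ σ.support := by
  rw [h.isHead_iff, h.isHead_left_iff, h.isHead_right_iff,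
    h.commute_iff fun x => h.mem_block_of_right hσ]
  constructor
  · rintro (⟨j, hj⟩ | ⟨_, rfl | ⟨hc, j, hj⟩⟩)
    · exact (h.not_left_and_right hj.mem hσ).elim
    · exact (h.ne_of_right hσ rfl).elim
    · rw [h.right_unique hσ hj.mem] at *
      exact ⟨hj, hc⟩
  · rintro ⟨hc, hw⟩
    refine Or.inr ⟨fun τ hτ => ?_, Or.inr ⟨hw, i, hc⟩⟩
    obtain ⟨j, hj⟩ := mem_flatten_ofFn.1 hτ
    exact h.commute_left_right hj hσ (Or.inr hw)

theorem isHead_formPerm (h : Decomp α β w A B l L) :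
    IsHead L (List.ofFn w).formPerm ↔ ∀ i, A i = [] := by
  rw [h.isHead_iff, h.isHead_left_iff, h.isHead_right_iff]
  constructor
  · rintro (⟨j, hj⟩ | ⟨hc, -⟩)
    · exact (h.ne_of_left hj.mem rfl).elim
    · intro i
      by_contra hne
      obtain ⟨σ, hσ, hw⟩ := (h.left i).exists_mem_support hne (x := w i) (by simp)
      exact (h.commute_iff fun x => h.mem_block_of_left hσ).1
        (hc σ (mem_flatten_ofFn.2 ⟨i, hσ⟩)).symm hw
  · intro hA
    refine Or.inr ⟨fun τ hτ => ?_, Or.inl rfl⟩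
    obtain ⟨j, hj⟩ := mem_flatten_ofFn.1 hτ
    simp [hA] at hj

theorem isTail_formPerm (h : Decomp α β w A B l L) :
    IsTail L (List.ofFn w).formPerm ↔ ∀ i, B i = [] := by
  rw [h.isTail_iff, h.isTail_left_iff, h.isTail_right_iff]
  constructor
  · have key : (∀ τ ∈ (List.ofFn B).flatten, Commute τ (List.ofFn w).formPerm) →
        ∀ i, B i = [] := by
      intro hc i
      by_contra hne
      obtain ⟨σ, hσ, hw⟩ := (h.right i).exists_mem_support hne (x := w i) (by simp)
      exact (h.commute_iff fun x => h.mem_block_of_right hσ).1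
        (hc σ (mem_flatten_ofFn.2 ⟨i, hσ⟩)).symm hw
    rintro ((⟨j, hj⟩ | ⟨hc, -⟩) | ⟨⟨hc, -⟩, -⟩)
    · exact (h.ne_of_right hj.mem rfl).elim
    · exact key hc
    · exact key hc
  · intro hB
    refine Or.inl (Or.inr ⟨fun τ hτ => ?_, rfl⟩)
    obtain ⟨j, hj⟩ := mem_flatten_ofFn.1 hτ
    simp [hB] at hj

end Decomp

end DecompLemmas

section Uniqueness

variable {V : Type*} [Fintype V] [DecidableEq V]

namespace Decomp

variable {l : List V} {L L' : List (Perm V)}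

section

variable {m : ℕ} {α β : Fin (m + 2) → List V} {w : Fin (m + 2) → V}
  {A B : Fin (m + 2) → List (Perm V)} {i j : Fin (m + 2)} {x : V} {σ : Perm V}

theorem left_zero (h : Decomp α β w A B l L) : A 0 = [] := by
  rw [(h.left 0).eq_nil_iff, h.first, List.nil_append, List.length_singleton]

theorem head?_eq (h : Decomp α β w A B l L) : l.head? = some (w 0) := by
  rw [h.list_eq, List.ofFn_succ, List.flatten_cons, h.first]
  rfl

theorem root_notMem_left (h : Decomp α β w A B l L) (hσ : σ ∈ A i) : w 0 ∉ σ.support := by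
  intro hw
  obtain rfl := h.block_unique (j := 0) (h.mem_block_of_left hσ hw) (by simp)
  simp [h.left_zero] at hσ

theorem root_notMem_right (h : Decomp α β w A B l L) (hσ : σ ∈ B i) (hi : w i ∉ σ.support) :
    w 0 ∉ σ.support := by
  intro hw
  obtain rfl := h.block_unique (j := 0) (h.mem_block_of_right hσ hw) (by simp)
  exact hi hw

theorem isHead_filter_iff (h : Decomp α β w A B l L) :
    IsHead (L.filter fun τ => w 0 ∈ τ.support) σ ↔ σ = (List.ofFn w).formPerm := by
  have hA : (List.ofFn A).flatten.filter (fun τ => w 0 ∈ τ.support) = [] :=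
    List.filter_eq_nil_iff.2 fun τ hτ => by
      obtain ⟨i, hi⟩ := mem_flatten_ofFn.1 hτ
      simpa using h.root_notMem_left hi
  have hP : w 0 ∈ (List.ofFn w).formPerm.support := h.mem_support.2 ⟨0, rfl⟩
  rw [h.fact_eq, List.filter_append, hA, List.nil_append, List.filter_cons,
    if_pos (decide_eq_true hP), IsHead, or_iff_left, eq_comm]
  rintro ⟨hc, hσ⟩
  obtain ⟨hσB, hw⟩ := List.mem_filter.1 hσ.mem
  obtain ⟨i, hi⟩ := mem_flatten_ofFn.1 hσB
  exact h.root_notMem_right hi ((h.commute_iff fun x => h.mem_block_of_right hi).1 hc)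
    (of_decide_eq_true hw)

theorem formPerm_pow_apply (h : Decomp α β w A B l L) (i : Fin (m + 2)) :
    ((List.ofFn w).formPerm ^ i.val) (w 0) = w i := by
  have hpow := List.formPerm_pow_apply_getElem (List.ofFn w) h.nodup_ofFn i.val 0 (by simp)
  simp only [List.getElem_ofFn, List.length_ofFn, zero_add, Nat.mod_eq_of_lt i.isLt] at hpow
  exact hpow

theorem mem_block_iff (h : Decomp α β w A B l L) (hx : x ∈ α j ++ w j :: β j) :
    x ∈ α i ++ w i :: β i ↔ i = j :=
  ⟨fun hi => h.block_unique hi hx, fun hij => hij ▸ hx⟩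

theorem exists_block (h : Decomp α β w A B l L) (hσ : σ ∈ L) (hne : σ ≠ (List.ofFn w).formPerm) :
    ∃ j, ∀ x ∈ σ.support, x ∈ α j ++ w j :: β j := by
  obtain ⟨j, hj⟩ | hP | ⟨j, hj⟩ := h.mem_fact.1 hσ
  · exact ⟨j, fun x => h.mem_block_of_left hj⟩
  · exact (hne hP).elim
  · exact ⟨j, fun x => h.mem_block_of_right hj⟩

theorem apply_mem_block (h : Decomp α β w A B l L) (hσ : σ ∈ L)
    (hne : σ ≠ (List.ofFn w).formPerm) (i : Fin (m + 2)) (x : V) :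
    (σ x ∈ α i ++ w i :: β i) = (x ∈ α i ++ w i :: β i) := by
  obtain ⟨j, hj⟩ := h.exists_block hσ hne
  refine apply_eq_of_forall_mem_support (κ := (· ∈ α i ++ w i :: β i)) (fun y hy z hz => ?_) x
  rw [h.mem_block_iff (hj y hy), h.mem_block_iff (hj z hz)]

theorem mem_left_iff (h : Decomp α β w A B l L) :
    σ ∈ A i ↔ σ ∈ L ∧ ∀ x ∈ σ.support, x ∈ α i ++ [w i] := by
  refine ⟨fun hσ => ⟨h.mem_fact.2 (.inl ⟨i, hσ⟩), (h.left i).mem_of_mem_support σ hσ⟩, ?_⟩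
  rintro ⟨hσ, hsub⟩
  have hblock : ∀ x ∈ σ.support, x ∈ α i ++ w i :: β i := fun x hx =>
    ((List.sublist_append_left [w i] (β i)).append_left (α i)).subset (hsub x hx)
  obtain ⟨j, hj⟩ | rfl | ⟨j, hj⟩ := h.mem_fact.1 hσ
  · obtain ⟨x, hx⟩ := support_nonempty_of_isCycle ((h.left j).isCycle σ hj)
    exact h.block_unique (hblock x hx) (h.mem_block_of_left hj hx) ▸ hj
  · exact (h.not_subset_block i hblock).elim
  · obtain ⟨x, hx, hne⟩ := Finset.exists_mem_ne (h.two_le_right hj) (w i)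
    exact (hne (h.eq_w_of_mem (hsub x hx) ((h.right j).mem_of_mem_support σ hj x hx)).2).elim

theorem mem_right_iff (h : Decomp α β w A B l L) :
    σ ∈ B i ↔ σ ∈ L ∧ ∀ x ∈ σ.support, x ∈ w i :: β i := by
  refine ⟨fun hσ => ⟨h.mem_fact.2 (.inr (.inr ⟨i, hσ⟩)), (h.right i).mem_of_mem_support σ hσ⟩, ?_⟩
  rintro ⟨hσ, hsub⟩
  have hblock : ∀ x ∈ σ.support, x ∈ α i ++ w i :: β i := fun x hx =>
    List.mem_append_right _ (hsub x hx)
  obtain ⟨j, hj⟩ | rfl | ⟨j, hj⟩ := h.mem_fact.1 hσ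
  · obtain ⟨x, hx, hne⟩ := Finset.exists_mem_ne (h.two_le_left hj) (w j)
    exact (hne (h.eq_w_of_mem ((h.left j).mem_of_mem_support σ hj x hx) (hsub x hx)).2).elim
  · exact (h.not_subset_block i hblock).elim
  · obtain ⟨x, hx⟩ := support_nonempty_of_isCycle ((h.right j).isCycle σ hj)
    exact h.block_unique (hblock x hx) (h.mem_block_of_right hj hx) ▸ hj

theorem left_eq_filter (h : Decomp α β w A B l L) (i : Fin (m + 2)) :
    A i = L.filter fun σ => ∀ x ∈ σ.support, x ∈ α i ++ [w i] := by
  have hsub : (A i).Sublist L := by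
    rw [h.fact_eq]
    exact (sublist_flatten_ofFn A i).trans (List.sublist_append_left _ _)
  rw [eq_filter_of_sublist hsub h.minFact.nodup_factors]
  refine List.filter_congr fun σ hσ => decide_eq_decide.2 ?_
  rw [h.mem_left_iff, and_iff_right hσ]

theorem right_eq_filter (h : Decomp α β w A B l L) (i : Fin (m + 2)) :
    B i = L.filter fun σ => ∀ x ∈ σ.support, x ∈ w i :: β i := by
  have hsub : (B i).Sublist L := by
    rw [h.fact_eq]
    exact (sublist_flatten_ofFn B i).trans
      ((List.sublist_cons_self _ _).trans (List.sublist_append_right _ _))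
  rw [eq_filter_of_sublist hsub h.minFact.nodup_factors]
  refine List.filter_congr fun σ hσ => decide_eq_decide.2 ?_
  rw [h.mem_right_iff, and_iff_right hσ]

end

section

variable {m m' : ℕ} {α β : Fin (m + 2) → List V} {w : Fin (m + 2) → V}
  {A B : Fin (m + 2) → List (Perm V)} {α' β' : Fin (m' + 2) → List V} {w' : Fin (m' + 2) → V}
  {A' B' : Fin (m' + 2) → List (Perm V)}

theorem root_eq (h : Decomp α β w A B l L) (h' : Decomp α' β' w' A' B' l L') : w 0 = w' 0 :=
  Option.some.inj (h.head?_eq.symm.trans h'.head?_eq)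

theorem formPerm_eq (h : Decomp α β w A B l L) (h' : Decomp α' β' w' A' B' l L')
    (hL : TraceEquiv L L') : (List.ofFn w).formPerm = (List.ofFn w').formPerm := by
  rw [← h'.isHead_filter_iff, ← (hL.filter _).isHead_iff, ← h.root_eq h', h.isHead_filter_iff]

theorem arity_eq (h : Decomp α β w A B l L) (h' : Decomp α' β' w' A' B' l L')
    (hL : TraceEquiv L L') : m = m' := by
  have hcard := h.card_support
  rw [h.formPerm_eq h' hL, h'.card_support] at hcard
  exact (Nat.add_right_cancel hcard).symm

end

variable {m : ℕ} {α β : Fin (m + 2) → List V} {w : Fin (m + 2) → V}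
  {A B : Fin (m + 2) → List (Perm V)} {α' β' : Fin (m + 2) → List V} {w' : Fin (m + 2) → V}
  {A' B' : Fin (m + 2) → List (Perm V)}

theorem points_eq (h : Decomp α β w A B l L) (h' : Decomp α' β' w' A' B' l L')
    (hL : TraceEquiv L L') : w = w' := by
  funext i
  rw [← h.formPerm_pow_apply, ← h'.formPerm_pow_apply, h.root_eq h', h.formPerm_eq h' hL]

theorem block_subset (h : Decomp α β w A B l L) (h' : Decomp α' β' w' A' B' l L')
    (hL : TraceEquiv L L') (i : Fin (m + 2)) : α i ++ w i :: β i ⊆ α' i ++ w' i :: β' i := by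
  have hwi : w i ∈ α' i ++ w' i :: β' i := by simp [h.points_eq h' hL]
  have hinv : ∀ σ ∈ L, σ ≠ (List.ofFn w).formPerm → ∀ x,
      (σ x ∈ α' i ++ w' i :: β' i) = (x ∈ α' i ++ w' i :: β' i) := fun σ hσ hne =>
    h'.apply_mem_block (hL.perm.mem_iff.1 hσ) (h.formPerm_eq h' hL ▸ hne) i
  rw [List.append_subset]
  constructor <;> intro x hx
  · exact (eq_of_prod_eq_formPerm (h.left i).nodup (h.left i).prod_eq
      (fun σ hσ => hinv σ (h.mem_left_iff.1 hσ).1 (h.ne_of_left hσ))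
      (List.mem_append_left _ hx) (by simp)).mpr hwi
  · exact (eq_of_prod_eq_formPerm (h.right i).nodup (h.right i).prod_eq
      (fun σ hσ => hinv σ (h.mem_right_iff.1 hσ).1 (h.ne_of_right hσ)) hx (by simp)).mpr hwi

theorem block_eq_filter (h : Decomp α β w A B l L) (i : Fin (m + 2)) :
    α i ++ w i :: β i = l.filter (· ∈ α i ++ w i :: β i) :=
  eq_filter_of_sublist (h.list_eq ▸ sublist_flatten_ofFn (fun i => α i ++ w i :: β i) i) h.nodup

theorem blocks_eq (h : Decomp α β w A B l L) (h' : Decomp α' β' w' A' B' l L')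
    (hL : TraceEquiv L L') : α = α' ∧ β = β' := by
  simp only [funext_iff, ← forall_and]
  intro i
  have hblock : α i ++ w i :: β i = α' i ++ w' i :: β' i := by
    rw [h.block_eq_filter, h'.block_eq_filter]
    exact List.filter_congr fun x _ => decide_eq_decide.2
      ⟨fun hx => h.block_subset h' hL i hx, fun hx => h'.block_subset h hL.symm i hx⟩
  rw [← h.points_eq h' hL] at hblock
  obtain ⟨-, hβ, hα⟩ := List.nodup_append.1 (h.block_nodup i)
  have hα : w i ∉ α i := fun hw => hα _ hw _ List.mem_cons_self rfl
  exact ((List.append_cons_inj_of_notMem hα (List.nodup_cons.1 hβ).1).1 hblock).imp_right And.right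

theorem pieces_traceEquiv (h : Decomp α β w A B l L) (h' : Decomp α' β' w' A' B' l L')
    (hL : TraceEquiv L L') (i : Fin (m + 2)) :
    TraceEquiv (A i) (A' i) ∧ TraceEquiv (B i) (B' i) := by
  obtain ⟨rfl, rfl⟩ := h.blocks_eq h' hL
  obtain rfl := h.points_eq h' hL
  rw [h.left_eq_filter, h.right_eq_filter, h'.left_eq_filter, h'.right_eq_filter]
  exact ⟨hL.filter _, hL.filter _⟩

end Decomp

end Uniqueness

/-! ### Weights -/

section Weights

variable {V : Type*} [Fintype V] [DecidableEq V] {L L' : List (Perm V)} {c : Len → Var}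
  {p q : Perm V → Prop} {σ : Perm V}

/-- The length of a cycle. Permutations with at most one moved point get the length `2`. -/
def cycleLen (σ : Perm V) : Len := ⟨max 2 σ.support.card, le_max_left _ _⟩

theorem cycleLen_eq {j : Len} (h : σ.support.card = j.1) : cycleLen σ = j :=
  Subtype.ext ((congrArg (max 2) h).trans (max_eq_right j.2))

theorem cycleLen_inv (σ : Perm V) : cycleLen σ⁻¹ = cycleLen σ := by
  simp only [cycleLen, Perm.support_inv]

/-- The number `m + 2` as the length of a cycle. -/
def len (m : ℕ) : Len := ⟨m + 2, Nat.le_add_left 2 m⟩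

open Classical in
/-- The monomial that records the lengths of the factors in `L` with the property `p` by the
variables `c j`. -/
def markWeight (c : Len → Var) (p : Perm V → Prop) (L : List (Perm V)) : Var →₀ ℕ :=
  (L.map fun σ => if p σ then Finsupp.single (c (cycleLen σ)) 1 else 0).sum

open Classical in
theorem markWeight_cons : markWeight c p (σ :: L) =
    (if p σ then Finsupp.single (c (cycleLen σ)) 1 else 0) + markWeight c p L := by
  rw [markWeight, List.map_cons, List.sum_cons, markWeight]

theorem markWeight_append : markWeight c p (L ++ L') = markWeight c p L + markWeight c p L' := by
  rw [markWeight, List.map_append, List.sum_append, markWeight, markWeight]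

theorem markWeight_flatten_ofFn {k : ℕ} (A : Fin k → List (Perm V)) :
    markWeight c p (List.ofFn A).flatten = ∑ i, markWeight c p (A i) := by
  simp only [markWeight, List.map_flatten, List.sum_flatten, List.map_ofFn, List.sum_ofFn,
    Function.comp_def]

theorem markWeight_congr (h : ∀ σ ∈ L, (p σ ↔ q σ)) : markWeight c p L = markWeight c q L := by
  classical
  exact congrArg List.sum (List.map_congr_left fun σ hσ => if_congr (h σ hσ) rfl rfl)

theorem markWeight_perm (h : L.Perm L') : markWeight c p L = markWeight c p L' :=
  (h.map _).sum_eq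

theorem markWeight_revInv : markWeight c p (revInv L) = markWeight c (fun σ => p σ⁻¹) L := by
  rw [revInv, markWeight_perm (List.reverse_perm _), markWeight, List.map_map, markWeight]
  simp only [Function.comp_def, cycleLen_inv]

theorem mapDomain_markWeight (φ : Var → Var) :
    (markWeight c p L).mapDomain φ = markWeight (φ ∘ c) p L := by
  induction L with
  | nil => rfl
  | cons σ L ih =>
    rw [markWeight_cons, markWeight_cons, Finsupp.mapDomain_add, ih,
      apply_ite (Finsupp.mapDomain φ), Finsupp.mapDomain_single, Finsupp.mapDomain_zero]
    rfl

/-- The monomial that records all the factors by `x`, the tails by `v`, and the heads that fix the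
point `r` by `u`. -/
def rootWeight (r : V) (L : List (Perm V)) : Var →₀ ℕ :=
  markWeight Var.x (fun _ => True) L + markWeight Var.v (IsTail L) L +
    markWeight Var.u (fun σ => IsHead L σ ∧ r ∉ σ.support) L

/-- The mirror image of `rootWeight`: it records all the factors by `x`, the tails that fix the
point `r` by `v`, and the heads by `u`. -/
def mirrorWeight (r : V) (L : List (Perm V)) : Var →₀ ℕ :=
  markWeight Var.x (fun _ => True) L +
    markWeight Var.v (fun σ => IsTail L σ ∧ r ∉ σ.support) L + markWeight Var.u (IsHead L) L

/-- The monomial that records all the factors by `x`, the tails by `v`, and the heads by `u`. -/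
def fullWeight (L : List (Perm V)) : Var →₀ ℕ :=
  markWeight Var.x (fun _ => True) L + markWeight Var.v (IsTail L) L +
    markWeight Var.u (IsHead L) L

theorem mapDomain_rootWeight_revInv (r : V) (L : List (Perm V)) :
    (rootWeight r (revInv L)).mapDomain swapVar = mirrorWeight r L := by
  simp only [rootWeight, Finsupp.mapDomain_add, mapDomain_markWeight, markWeight_revInv,
    isTail_revInv, isHead_revInv, Perm.support_inv, inv_inv]
  rw [mirrorWeight, add_right_comm]
  rfl

theorem TraceEquiv.fullWeight_eq (h : TraceEquiv L L') : fullWeight L = fullWeight L' := by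
  rw [fullWeight, fullWeight, markWeight_perm h.perm, markWeight_perm h.perm,
    markWeight_perm h.perm, markWeight_congr fun _ _ => h.isTail_iff,
    markWeight_congr fun _ _ => h.isHead_iff]

end Weights

namespace Decomp

variable {V : Type*} [Fintype V] [DecidableEq V] {m : ℕ} {α β : Fin (m + 2) → List V}
  {w : Fin (m + 2) → V} {A B : Fin (m + 2) → List (Perm V)} {l : List V} {L : List (Perm V)}
  {c : Len → Var} {p : Perm V → Prop}

open Classical in
theorem markWeight_eq (h : Decomp α β w A B l L) : markWeight c p L =
    ∑ i, markWeight c p (A i) +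
      ((if p (List.ofFn w).formPerm then Finsupp.single (c (len m)) 1 else 0) +
      ∑ i, markWeight c p (B i)) := by
  rw [h.fact_eq, markWeight_append, markWeight_cons, markWeight_flatten_ofFn,
    markWeight_flatten_ofFn, cycleLen_eq (j := len m) h.card_support]

open Classical in
theorem markWeight_isTail (h : Decomp α β w A B l L) : markWeight c (IsTail L) L =
    ∑ i, markWeight c (fun σ => IsTail (A i) σ ∧ w i ∉ σ.support) (A i) +
      ((if ∀ i, B i = [] then Finsupp.single (c (len m)) 1 else 0) +
      ∑ i, markWeight c (IsTail (B i)) (B i)) := by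
  have hA := fun i => markWeight_congr (c := c) fun σ (hσ : σ ∈ A i) => h.isTail_of_mem_left hσ
  have hB := fun i => markWeight_congr (c := c) fun σ (hσ : σ ∈ B i) => h.isTail_of_mem_right hσ
  rw [h.markWeight_eq, if_congr h.isTail_formPerm rfl rfl]
  simp only [hA, hB]

open Classical in
theorem markWeight_isHead (h : Decomp α β w A B l L) : markWeight c (IsHead L) L =
    ∑ i, markWeight c (IsHead (A i)) (A i) +
      ((if ∀ i, A i = [] then Finsupp.single (c (len m)) 1 else 0) +
      ∑ i, markWeight c (fun σ => IsHead (B i) σ ∧ w i ∉ σ.support) (B i)) := by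
  have hA := fun i => markWeight_congr (c := c) fun σ (hσ : σ ∈ A i) => h.isHead_of_mem_left hσ
  have hB := fun i => markWeight_congr (c := c) fun σ (hσ : σ ∈ B i) => h.isHead_of_mem_right hσ
  rw [h.markWeight_eq, if_congr h.isHead_formPerm rfl rfl]
  simp only [hA, hB]

theorem markWeight_isHead_root (h : Decomp α β w A B l L) :
    markWeight c (fun σ => IsHead L σ ∧ w 0 ∉ σ.support) L =
      ∑ i, markWeight c (IsHead (A i)) (A i) +
        ∑ i, markWeight c (fun σ => IsHead (B i) σ ∧ w i ∉ σ.support) (B i) := by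
  classical
  have hA : ∀ i, ∀ σ ∈ A i, IsHead L σ ∧ w 0 ∉ σ.support ↔ IsHead (A i) σ := fun i σ hσ =>
    (and_iff_left (h.root_notMem_left hσ)).trans (h.isHead_of_mem_left hσ)
  have hB : ∀ i, ∀ σ ∈ B i,
      IsHead L σ ∧ w 0 ∉ σ.support ↔ IsHead (B i) σ ∧ w i ∉ σ.support := fun i σ hσ =>
    (and_congr_left' (h.isHead_of_mem_right hσ)).trans
      (and_iff_left_of_imp fun hc => h.root_notMem_right hσ hc.2)
  have hA' := fun i => markWeight_congr (c := c) (hA i)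
  have hB' := fun i => markWeight_congr (c := c) (hB i)
  rw [h.markWeight_eq, if_neg fun hc => hc.2 (h.mem_support.2 ⟨0, rfl⟩), zero_add]
  simp only [hA', hB']

open Classical in
theorem rootWeight_eq (h : Decomp α β w A B l L) : rootWeight (w 0) L =
    Finsupp.single (Var.x (len m)) 1 +
      (if ∀ i, B i = [] then Finsupp.single (Var.v (len m)) 1 else 0) +
      ∑ i, rootWeight (w i) (B i) + ∑ i, mirrorWeight (w i) (A i) := by
  rw [rootWeight, h.markWeight_eq, h.markWeight_isTail, h.markWeight_isHead_root, if_pos trivial]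
  simp only [rootWeight, mirrorWeight, Finset.sum_add_distrib]
  abel

open Classical in
theorem fullWeight_eq (h : Decomp α β w A B l L) : fullWeight L = rootWeight (w 0) L +
    if ∀ i, A i = [] then Finsupp.single (Var.u (len m)) 1 else 0 := by
  rw [fullWeight, rootWeight, h.markWeight_isHead, h.markWeight_isHead_root]
  abel

end Decomp

/-! ### Trees -/

/-- The shapes of minimal factorizations. A tree is empty, or its root stands for an
`(m + 2)`-cycle and carries a tree `b i` on the right of each point of this cycle and a tree `a i`
on the left of each of its points other than the first. -/
inductive Tree : Type
  | nil : Tree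
  | node (m : ℕ) (b : Fin (m + 2) → Tree) (a : Fin (m + 1) → Tree) : Tree

namespace Tree

/-- The number of points, apart from the root, of the factorizations with the shape of the tree. -/
def rank : Tree → ℕ
  | nil => 0
  | node m b a => m + 1 + ∑ i, rank (b i) + ∑ i, rank (a i)

open Classical in
/-- The monomial of a tree in `f`, see `Tree.Rep.rootWeight_eq`. A factorization on the left of a
point is read backwards, which exchanges heads and tails. -/
def weight : Tree → Var →₀ ℕ
  | nil => 0
  | node m b a => Finsupp.single (Var.x (len m)) 1 +
      (if ∀ i, b i = nil then Finsupp.single (Var.v (len m)) 1 else 0) +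
      ∑ i, weight (b i) + ∑ i, (weight (a i)).mapDomain swapVar

open Classical in
/-- The monomial of a tree in `g`, see `Tree.Rep.fullWeight_eq`. -/
def fullWeight : Tree → Var →₀ ℕ
  | nil => 0
  | node m b a => weight (node m b a) +
      if ∀ i, a i = nil then Finsupp.single (Var.u (len m)) 1 else 0

variable {V : Type*} [Fintype V] [DecidableEq V]

/-- The factorization `L` of the cycle through `l` has the shape of the tree. The factors on the
left of a point are read backwards, so that this point is again the first one of their list. -/
def Rep : Tree → List V → List (Perm V) → Prop
  | nil, l, L => L = [] ∧ l.length = 1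
  | node m b a, l, L => ∃ (α β : Fin (m + 2) → List V) (w : Fin (m + 2) → V)
      (A B : Fin (m + 2) → List (Perm V)), Decomp α β w A B l L ∧
        (∀ i, Rep (b i) (w i :: β i) (B i)) ∧
        ∀ i : Fin (m + 1), Rep (a i) (w i.succ :: (α i.succ).reverse) (revInv (A i.succ))

namespace Rep

variable {t t' : Tree} {l : List V} {L L' : List (Perm V)}

theorem minFact (h : Rep t l L) : MinFact l L := by
  cases t with
  | nil =>
    obtain ⟨rfl, hl⟩ := h
    obtain ⟨a, rfl⟩ := List.length_eq_one_iff.1 hl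
    exact minFact_singleton a
  | node m b a =>
    obtain ⟨α, β, w, A, B, hd, -⟩ := h
    exact hd.minFact

theorem eq_nil_iff (h : Rep t l L) : L = [] ↔ t = nil := by
  cases t with
  | nil => exact iff_of_true h.1 rfl
  | node m b a =>
    obtain ⟨α, β, w, A, B, hd, -⟩ := h
    simp [hd.fact_eq]

theorem node {m : ℕ} {b : Fin (m + 2) → Tree} {a : Fin (m + 1) → Tree}
    {α β : Fin (m + 2) → List V} {w : Fin (m + 2) → V} {A : Fin (m + 1) → List (Perm V)}
    {B : Fin (m + 2) → List (Perm V)} (hnd : l.Nodup)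
    (hl : l = (List.ofFn fun i => α i ++ w i :: β i).flatten) (hα : α 0 = [])
    (hB : ∀ i, Rep (b i) (w i :: β i) (B i))
    (hA : ∀ i, Rep (a i) (w i.succ :: (α i.succ).reverse) (A i)) :
    Rep (.node m b a) l ((List.ofFn (Fin.cons [] fun i => revInv (A i))).flatten ++
      (List.ofFn w).formPerm :: (List.ofFn B).flatten) := by
  refine ⟨α, β, w, Fin.cons [] fun i => revInv (A i), B,
    ⟨hnd, hl, rfl, ?_, fun i => (hB i).minFact, hα⟩, hB, fun i => ?_⟩
  · refine Fin.cases ?_ fun i => ?_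
    · rw [hα, Fin.cons_zero]
      exact minFact_singleton _
    · simpa using (hA i).minFact.revInv
  · rw [Fin.cons_succ, revInv_revInv]
    exact hA i

theorem length_eq (h : Rep t l L) : l.length = t.rank + 1 := by
  induction t generalizing l L with
  | nil => exact h.2
  | node m b a ihb iha =>
    obtain ⟨α, β, w, A, B, hd, hb, ha⟩ := h
    have hβ := fun i => ihb i (hb i)
    have hα := fun i => iha i (ha i)
    simp only [List.length_cons, List.length_reverse, add_left_inj] at hβ hα
    have hlen := congrArg List.length hd.list_eq
    simp only [List.length_flatten, List.map_ofFn, List.sum_ofFn, Function.comp_def,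
      List.length_append, List.length_cons, Finset.sum_add_distrib, Finset.sum_const,
      Finset.card_univ, Fintype.card_fin, smul_eq_mul, mul_one,
      Fin.sum_univ_succ (fun i => (α i).length), hd.first, hα, hβ, List.length_nil] at hlen
    rw [hlen, rank]
    ring

theorem rootWeight_eq {r : V} (h : Rep t (r :: l) L) : rootWeight r L = t.weight := by
  classical
  induction t generalizing r l L with
  | nil =>
    rw [h.1]
    rfl
  | node m b a ihb iha =>
    obtain ⟨α, β, w, A, B, hd, hb, ha⟩ := h
    obtain rfl : r = w 0 := Option.some.inj hd.head?_eq
    have hB := fun i => ihb i (hb i)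
    have hA := fun i => iha i (ha i)
    have hA₀ : mirrorWeight (w 0) (A 0) = 0 := by
      rw [hd.left_zero]
      rfl
    rw [hd.rootWeight_eq, Fin.sum_univ_succ (fun i => mirrorWeight (w i) (A i)), hA₀, zero_add,
      weight, if_congr (forall_congr' fun i => (hb i).eq_nil_iff) rfl rfl]
    simp only [hB, ← mapDomain_rootWeight_revInv, hA]

theorem fullWeight_eq (h : Rep t l L) : CycleFactorization.fullWeight L = t.fullWeight := by
  classical
  cases t with
  | nil =>
    rw [h.1]
    rfl
  | node m b a =>
    obtain ⟨r, l, rfl⟩ := List.exists_cons_of_ne_nil h.minFact.ne_nil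
    have hweight := h.rootWeight_eq
    obtain ⟨α, β, w, A, B, hd, -, ha⟩ := h
    obtain rfl : r = w 0 := Option.some.inj hd.head?_eq
    have hA : (∀ i, A i = []) ↔ ∀ i, a i = nil := by
      rw [Fin.forall_fin_succ, and_iff_right hd.left_zero]
      exact forall_congr' fun i => by rw [← (ha i).eq_nil_iff, revInv_eq_nil]
    rw [hd.fullWeight_eq, hweight, fullWeight, if_congr hA rfl rfl]

theorem tree_unique (h : Rep t l L) (h' : Rep t' l L') (hL : TraceEquiv L L') : t = t' := by
  induction t generalizing t' l L L' with
  | nil => exact (h'.eq_nil_iff.1 (List.nil_perm.1 (h.1 ▸ hL.perm))).symm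
  | node m b a ihb iha =>
    cases t' with
    | nil => exact h.eq_nil_iff.1 (List.perm_nil.1 (h'.1 ▸ hL.perm))
    | node m' b' a' =>
      obtain ⟨α, β, w, A, B, hd, hb, ha⟩ := h
      obtain ⟨α', β', w', A', B', hd', hb', ha'⟩ := h'
      obtain rfl := hd.arity_eq hd' hL
      obtain ⟨rfl, rfl⟩ := hd.blocks_eq hd' hL
      obtain rfl := hd.points_eq hd' hL
      have hpieces := hd.pieces_traceEquiv hd' hL
      congr 1
      · exact funext fun i => ihb i (hb i) (hb' i) (hpieces i).2
      · exact funext fun i => iha i (ha i) (ha' i) (hpieces i.succ).1.revInv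

end Rep

end Tree

theorem eq_of_flatten_ofFn_eq {V : Type*} {k : ℕ} {α β α' β' : Fin k → List V} {w w' : Fin k → V}
    (h : (List.ofFn fun i => α i ++ w i :: β i).flatten =
      (List.ofFn fun i => α' i ++ w' i :: β' i).flatten)
    (hα : ∀ i, (α i).length = (α' i).length) (hβ : ∀ i, (β i).length = (β' i).length) :
    α = α' ∧ w = w' ∧ β = β' := by
  have hlist : (List.ofFn fun i => α i ++ w i :: β i) =
      List.ofFn fun i => α' i ++ w' i :: β' i := by
    rw [List.eq_iff_flatten_eq]
    refine ⟨h, ?_⟩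
    simp only [List.map_ofFn, Function.comp_def, List.length_append, List.length_cons, hα, hβ]
  have hpieces := fun i => List.append_inj (congrFun (List.ofFn_injective hlist) i) (hα i)
  have hcons := fun i => List.cons.inj (hpieces i).2
  exact ⟨funext fun i => (hpieces i).1, funext fun i => (hcons i).1, funext fun i => (hcons i).2⟩

theorem exists_flatten_ofFn {V : Type*} {k : ℕ} (s r : Fin k → ℕ) (l : List V)
    (hl : l.length = ∑ i, (s i + (r i + 1))) :
    ∃ (α β : Fin k → List V) (w : Fin k → V), (∀ i, (α i).length = s i) ∧
      (∀ i, (β i).length = r i) ∧ l = (List.ofFn fun i => α i ++ w i :: β i).flatten := by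
  induction k generalizing l with
  | zero =>
    refine ⟨Fin.elim0, Fin.elim0, Fin.elim0, fun i => i.elim0, fun i => i.elim0, ?_⟩
    simpa using hl
  | succ k ih =>
    rw [Fin.sum_univ_succ] at hl
    obtain ⟨α, β, w, hα, hβ, hl'⟩ := ih (fun i => s i.succ) (fun i => r i.succ)
      (l.drop (s 0 + (r 0 + 1))) (by rw [List.length_drop]; omega)
    obtain ⟨y, z, hz⟩ := List.exists_cons_of_length_eq_add_one
      (show ((l.take (s 0 + (r 0 + 1))).drop (s 0)).length = r 0 + 1 by simp; omega)
    have hz' : z.length = r 0 := by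
      have hlen := congrArg List.length hz
      simp only [List.length_drop, List.length_take, List.length_cons] at hlen
      omega
    refine ⟨Fin.cons ((l.take (s 0 + (r 0 + 1))).take (s 0)) α, Fin.cons z β, Fin.cons y w,
      Fin.cases (by simp; omega) hα, Fin.cases hz' hβ, ?_⟩
    simp [List.ofFn_succ, ← hl', ← hz]

namespace Tree

variable {V : Type*} [Fintype V] [DecidableEq V] {t : Tree} {l : List V} {L L' : List (Perm V)}

theorem Rep.list_unique (h : Rep t l L) (h' : Rep t l L') : L = L' := by
  induction t generalizing l L L' with
  | nil => rw [h.1, h'.1]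
  | node m b a ihb iha =>
    obtain ⟨α, β, w, A, B, hd, hb, ha⟩ := h
    obtain ⟨α', β', w', A', B', hd', hb', ha'⟩ := h'
    have hβ : ∀ i, (β i).length = (β' i).length := fun i => by
      simpa using (hb i).length_eq.trans (hb' i).length_eq.symm
    have hα : ∀ i, (α i).length = (α' i).length := by
      refine Fin.cases (by rw [hd.first, hd'.first]) fun i => ?_
      simpa using (ha i).length_eq.trans (ha' i).length_eq.symm
    obtain ⟨rfl, rfl, rfl⟩ := eq_of_flatten_ofFn_eq (hd.list_eq.symm.trans hd'.list_eq) hα hβ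
    have hB : B = B' := funext fun i => ihb i (hb i) (hb' i)
    have hA : A = A' := funext <| Fin.cases (by rw [hd.left_zero, hd'.left_zero]) fun i => by
      rw [← revInv_revInv (A i.succ), iha i (ha i) (ha' i), revInv_revInv]
    rw [hd.fact_eq, hd'.fact_eq, hA, hB]

theorem exists_rep (t : Tree) (l : List V) (hnd : l.Nodup) (hl : l.length = t.rank + 1) :
    ∃ L, Rep t l L := by
  induction t generalizing l with
  | nil => exact ⟨[], rfl, hl⟩
  | node m b a ihb iha =>
    obtain ⟨α, β, w, hα, hβ, hlist⟩ := exists_flatten_ofFn (Fin.cons 0 fun i => (a i).rank)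
      (fun i => (b i).rank) l (by
        rw [hl, rank]
        simp only [Finset.sum_add_distrib, Finset.sum_const, Finset.card_univ, Fintype.card_fin,
          smul_eq_mul, mul_one, Fin.sum_univ_succ (Fin.cons 0 _), Fin.cons_zero, Fin.cons_succ]
        ring)
    have hblock : ∀ i, (α i ++ w i :: β i).Nodup := fun i =>
      (hlist ▸ hnd).sublist (sublist_flatten_ofFn (fun i => α i ++ w i :: β i) i)
    have hright : ∀ i, (w i :: β i).Nodup := fun i =>
      (hblock i).sublist (List.sublist_append_right _ _)
    have hleft : ∀ i, (w i :: (α i).reverse).Nodup := fun i => by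
      rw [← List.nodup_reverse, List.reverse_cons, List.reverse_reverse]
      exact (hblock i).sublist (by simp)
    choose B hB using fun i => ihb i _ (hright i) (by simp [hβ])
    choose A hA using fun i : Fin (m + 1) => iha i _ (hleft i.succ) (by simp [hα])
    exact ⟨_, .node hnd hlist (List.eq_nil_of_length_eq_zero (hα 0)) hB hA⟩

end Tree

theorem MinFact.exists_rep {V : Type*} [Fintype V] [DecidableEq V] {l : List V}
    {L : List (Perm V)} (h : MinFact l L) : ∃ t L', TraceEquiv L L' ∧ Tree.Rep t l L' := by
  induction hN : L.length using Nat.strong_induction_on generalizing l L with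
  | _ N ih =>
    obtain rfl | hL := eq_or_ne L []
    · exact ⟨.nil, [], .refl _, rfl, h.eq_nil_iff.1 rfl⟩
    obtain ⟨m, α, β, w, A, B, L₀, hL₀, hd⟩ := h.exists_decomp hL
    have hlen : (List.ofFn A).flatten.length + ((List.ofFn B).flatten.length + 1) = N := by
      rw [← hN, hL₀.perm.length_eq, hd.fact_eq, List.length_append, List.length_cons]
    have hltB : ∀ i, (B i).length < N := fun i => by
      have := (sublist_flatten_ofFn B i).length_le
      omega
    have hltA : ∀ i, (CycleFactorization.revInv (A i)).length < N := fun i => by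
      have := (sublist_flatten_ofFn A i).length_le
      rw [CycleFactorization.revInv, List.length_reverse, List.length_map]
      omega
    have hleft : ∀ i, MinFact (w i :: (α i).reverse) (CycleFactorization.revInv (A i)) := by
      intro i
      simpa using (hd.left i).revInv
    choose b B' hBB' hB' using fun i => ih _ (hltB i) (hd.right i) rfl
    choose a A' hAA' hA' using fun i : Fin (m + 1) => ih _ (hltA i.succ) (hleft i.succ) rfl
    refine ⟨.node m b a, _, hL₀.trans ?_, .node hd.nodup hd.list_eq hd.first hB' hA'⟩
    rw [hd.fact_eq]
    have hright := (TraceEquiv.flatten_ofFn hBB').cons (List.ofFn w).formPerm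
    refine .append (.flatten_ofFn (Fin.cases ?_ fun i => ?_)) hright
    · rw [hd.left_zero]
      exact .refl _
    · rw [Fin.cons_succ, ← revInv_revInv (A i.succ)]
      exact (hAA' i).revInv

/-! ### The coefficients of `g` -/

section Counting

variable {V : Type*} [Fintype V] [DecidableEq V] {L : List (Perm V)} {c : Len → Var}
  {p : Perm V → Prop}

theorem cycleLen_eq_iff {σ : Perm V} (hσ : σ.IsCycle) {j : Len} :
    cycleLen σ = j ↔ σ.support.card = j.1 := by
  refine ⟨fun h => ?_, cycleLen_eq⟩
  rw [← h]
  exact (max_eq_right hσ.two_le_card_support).symm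

open Classical in
theorem markWeight_apply (hc : Function.Injective c) (hL : ∀ σ ∈ L, σ.IsCycle) (j : Len) :
    markWeight c p L (c j) = (L.filter fun σ => p σ ∧ σ.support.card = j.1).length := by
  induction L with
  | nil => rfl
  | cons σ L ih =>
    rw [List.forall_mem_cons] at hL
    rw [markWeight_cons, Finsupp.add_apply, ih hL.2, List.filter_cons]
    have hcard := cycleLen_eq_iff hL.1 (j := j)
    by_cases hp : p σ
    · by_cases hj : cycleLen σ = j
      · simp [hp, hj, hcard.1 hj, add_comm]
      · simp [hp, hj, mt hcard.2 hj, hc.eq_iff]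
    · simp [hp]

theorem markWeight_apply_of_ne {y : Var} (hy : ∀ j, c j ≠ y) : markWeight c p L y = 0 := by
  classical
  induction L with
  | nil => rfl
  | cons σ L ih =>
    rw [markWeight_cons, Finsupp.add_apply, ih]
    split_ifs <;> simp [hy]

theorem markWeight_apply_eq_ncard (hc : Function.Injective c) (hL : ∀ σ ∈ L, σ.IsCycle)
    (hnd : L.Nodup) (hp : ∀ σ, p σ → σ ∈ L) (j : Len) :
    markWeight c p L (c j) = {σ | p σ ∧ σ.support.card = j.1}.ncard := by
  classical
  rw [markWeight_apply hc hL, ← List.toFinset_card_of_nodup (hnd.filter _), ← Set.ncard_coe_finset]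
  congr 1
  ext σ
  simpa using fun h _ => hp σ h

theorem fullWeight_eq_iff (hL : ∀ σ ∈ L, σ.IsCycle) (hnd : L.Nodup) {e : Var →₀ ℕ} :
    fullWeight L = e ↔
      (∀ j : Len, (L.filter fun σ => σ.support.card = j.1).length = e (Var.x j)) ∧
      (∀ j : Len, {σ | IsHead L σ ∧ σ.support.card = j.1}.ncard = e (Var.u j)) ∧
      ∀ j : Len, {σ | IsTail L σ ∧ σ.support.card = j.1}.ncard = e (Var.v j) := by
  have hx : ∀ j, fullWeight L (Var.x j) = (L.filter fun σ => σ.support.card = j.1).length :=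
    fun j => by
      simp [fullWeight, markWeight_apply (c := Var.x) (fun _ _ => Var.x.inj) hL,
        markWeight_apply_of_ne]
  have hu : ∀ j, fullWeight L (Var.u j) = {σ | IsHead L σ ∧ σ.support.card = j.1}.ncard :=
    fun j => by
      simp [fullWeight, markWeight_apply_of_ne,
        markWeight_apply_eq_ncard (c := Var.u) (fun _ _ => Var.u.inj) hL hnd fun _ => IsHead.mem]
  have hv : ∀ j, fullWeight L (Var.v j) = {σ | IsTail L σ ∧ σ.support.card = j.1}.ncard :=
    fun j => by
      simp [fullWeight, markWeight_apply_of_ne,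
        markWeight_apply_eq_ncard (c := Var.v) (fun _ _ => Var.v.inj) hL hnd fun _ => IsTail.mem]
  simp only [← hx, ← hu, ← hv]
  refine ⟨fun h => h ▸ ⟨fun _ => rfl, fun _ => rfl, fun _ => rfl⟩, fun ⟨h₁, h₂, h₃⟩ => ?_⟩
  ext (j | j | j)
  exacts [h₁ j, h₃ j, h₂ j]

theorem rank_toFinsupp (s : Multiset Len) :
    rank (Multiset.toFinsupp s) = (s.map fun j => j.1 - 1).sum := by
  simp [Finset.sum_multiset_map_count, rank, Finsupp.sum, mul_comm]

theorem rank_eq_totalRank (hL : ∀ σ ∈ L, σ.IsCycle) {α : Len →₀ ℕ}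
    (h : ∀ j : Len, (L.filter fun σ => σ.support.card = j.1).length = α j) :
    rank α = totalRank L := by
  have hα : α = Multiset.toFinsupp (L.map cycleLen : Multiset Len) := by
    ext j
    rw [← h, Multiset.toFinsupp_apply, ← Multiset.map_coe, Multiset.count_map, Multiset.filter_coe,
      Multiset.coe_card]
    refine congrArg List.length (List.filter_congr fun σ hσ => decide_eq_decide.2 ?_)
    rw [← cycleLen_eq_iff (hL σ hσ), eq_comm]
  rw [hα, rank_toFinsupp, Multiset.map_coe, List.map_map, Multiset.sum_coe, totalRank]
  refine congrArg List.sum (List.map_congr_left fun σ hσ => ?_)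
  rw [(cycleLen_eq_iff (hL σ hσ)).1 rfl]
  rfl

end Counting

theorem formPerm_finRange (k : ℕ) : (List.finRange (k + 1)).formPerm = finRotate (k + 1) := by
  ext x
  have h := List.formPerm_apply_getElem (List.finRange (k + 1)) (List.nodup_finRange _) x.val
    (by simpa using x.isLt)
  simp only [List.getElem_finRange, Fin.eta, Fin.cast_mk, List.length_finRange] at h
  rw [h, finRotate_apply]
  simp [Fin.val_add]

theorem isFactorization_iff {α : Len →₀ ℕ} {L : List (Perm (Fin (rank α + 1)))} :
    IsFactorization (rank α + 1) α L ↔ MinFact (List.finRange (rank α + 1)) L ∧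
      ∀ j : Len, (L.filter fun σ => σ.support.card = j.1).length = α j where
  mp h := by
    refine ⟨⟨List.nodup_finRange _, h.isCycle, fun _ _ x _ => List.mem_finRange x, ?_, ?_⟩,
      h.type_eq⟩
    · rw [h.prod_eq, formPerm_finRange]
    · rw [← rank_eq_totalRank h.isCycle h.type_eq, List.length_finRange]
  mpr := fun ⟨h, htype⟩ => ⟨h.isCycle, htype, by rw [h.prod_eq, formPerm_finRange]⟩

namespace MinFactorization

variable {α : Len →₀ ℕ}

/-- The equivalence class of a minimal factorization. -/
def toClass (L : MinFactorization α) : FactClass α := Quotient.mk (equivalence α) L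

theorem toClass_eq_iff {L L' : MinFactorization α} :
    L.toClass = L'.toClass ↔ TraceEquiv L.1 L'.1 := Quotient.eq

theorem minFact (L : MinFactorization α) : MinFact (List.finRange (rank α + 1)) L.1 :=
  (isFactorization_iff.1 L.2).1

theorem exists_toClass_eq (L : MinFactorization α) {L' : List (Perm (Fin (rank α + 1)))}
    (h : TraceEquiv L.1 L') : ∃ K : MinFactorization α, K.toClass = L.toClass ∧ K.1 = L' :=
  ⟨⟨L', fun σ hσ => L.2.isCycle σ (h.perm.mem_iff.2 hσ),
    fun j => by rw [← L.2.type_eq j, (h.perm.filter _).length_eq],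
    by rw [← h.prod_eq, L.2.prod_eq]⟩, toClass_eq_iff.2 h.symm, rfl⟩

theorem mem_heads_toClass (L : MinFactorization α) {σ : Perm (Fin (rank α + 1))} :
    σ ∈ heads L.toClass ↔ IsHead L.1 σ := by
  rw [isHead_iff_exists_traceEquiv]
  constructor
  · rintro ⟨K, hK, hσ⟩
    obtain ⟨M, hM⟩ := List.head?_eq_some_iff.1 hσ
    exact ⟨M, hM ▸ (toClass_eq_iff.1 hK).symm⟩
  · rintro ⟨M, hM⟩
    obtain ⟨K, hK, hKM⟩ := L.exists_toClass_eq hM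
    exact ⟨K, hK, by rw [hKM, List.head?_cons]⟩

theorem mem_tails_toClass (L : MinFactorization α) {σ : Perm (Fin (rank α + 1))} :
    σ ∈ tails L.toClass ↔ IsTail L.1 σ := by
  rw [isTail_iff_exists_traceEquiv]
  constructor
  · rintro ⟨K, hK, hσ⟩
    obtain ⟨M, hM⟩ := List.getLast?_eq_some_iff.1 hσ
    exact ⟨M, hM ▸ (toClass_eq_iff.1 hK).symm⟩
  · rintro ⟨M, hM⟩
    obtain ⟨K, hK, hKM⟩ := L.exists_toClass_eq hM
    exact ⟨K, hK, by rw [hKM, List.getLast?_concat]⟩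

theorem fullWeight_eq_iff {e : Var →₀ ℕ} (hα : ∀ j, α j = e (Var.x j)) (L : MinFactorization α) :
    fullWeight L.1 = e ↔ (∀ j, headCount L.toClass j = e (Var.u j)) ∧
      ∀ j, tailCount L.toClass j = e (Var.v j) := by
  rw [CycleFactorization.fullWeight_eq_iff L.2.isCycle L.minFact.nodup_factors]
  simp only [headCount, tailCount, mem_heads_toClass, mem_tails_toClass]
  exact and_iff_right fun j => (L.2.type_eq j).trans (hα j)

end MinFactorization

namespace Tree

variable {T : Tree} {e : Var →₀ ℕ} {α : Len →₀ ℕ}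

theorem Rep.length_filter_eq {V : Type*} [Fintype V] [DecidableEq V] {l : List V}
    {L : List (Perm V)} (h : T.Rep l L) (j : Len) :
    (L.filter fun σ => σ.support.card = j.1).length = T.fullWeight (Var.x j) :=
  ((CycleFactorization.fullWeight_eq_iff h.minFact.isCycle h.minFact.nodup_factors).1
    h.fullWeight_eq).1 j

theorem rank_eq (hα : ∀ j, α j = T.fullWeight (Var.x j)) : T.rank = CycleFactorization.rank α := by
  obtain ⟨L, hL⟩ := T.exists_rep (List.finRange (T.rank + 1)) (List.nodup_finRange _) (by simp)
  have htotal := hL.minFact.rank_eq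
  rw [List.length_finRange, add_left_inj] at htotal
  rw [← htotal]
  exact (rank_eq_totalRank hL.minFact.isCycle fun j => by rw [hL.length_filter_eq, hα]).symm

theorem exists_minFactorization (hα : ∀ j, α j = T.fullWeight (Var.x j)) :
    ∃ L : MinFactorization α, T.Rep (List.finRange (CycleFactorization.rank α + 1)) L.1 := by
  obtain ⟨L, hL⟩ := T.exists_rep (List.finRange (CycleFactorization.rank α + 1))
    (List.nodup_finRange _) (by rw [T.rank_eq hα, List.length_finRange])
  exact ⟨⟨L, isFactorization_iff.2 ⟨hL.minFact, fun j => by rw [hL.length_filter_eq, hα]⟩⟩, hL⟩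

end Tree

theorem numFact_eq_ncard {e : Var →₀ ℕ} {α h t : Len →₀ ℕ} (hα : ∀ j, α j = e (Var.x j))
    (hh : ∀ j, h j = e (Var.u j)) (ht : ∀ j, t j = e (Var.v j)) :
    numFact α h t = {T : Tree | T.fullWeight = e}.ncard := by
  have hex : ∀ T ∈ {T : Tree | T.fullWeight = e},
      ∃ L : MinFactorization α, T.Rep (List.finRange (rank α + 1)) L.1 :=
    fun T hT => T.exists_minFactorization fun j => by rw [hα, hT]
  choose F hF using hex
  symm
  simp only [numFact, hh, ht]
  refine Set.ncard_congr (fun T hT => (F T hT).toClass) (fun T hT => ?_) (fun T T' hT hT' heq => ?_)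
    fun c hc => ?_
  · exact ((F T hT).fullWeight_eq_iff hα).1 ((hF T hT).fullWeight_eq.trans hT)
  · exact (hF T hT).tree_unique (hF T' hT') (MinFactorization.toClass_eq_iff.1 heq)
  · obtain ⟨L, rfl⟩ := Quotient.exists_rep c
    obtain ⟨T, L', hLL', hT⟩ := L.minFact.exists_rep
    have hTe : T.fullWeight = e := by
      rw [← hT.fullWeight_eq, ← hLL'.fullWeight_eq]
      exact (L.fullWeight_eq_iff hα).2 hc
    refine ⟨T, hTe, MinFactorization.toClass_eq_iff.2 ?_⟩
    rw [(hF T hTe).list_unique hT]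
    exact hLL'.symm

theorem coeff_g (e : Var →₀ ℕ) :
    MvPowerSeries.coeff e g = ({T : Tree | T.fullWeight = e}.ncard : ℤ) :=
  congrArg Nat.cast (numFact_eq_ncard (fun _ => rfl) (fun _ => rfl) fun _ => rfl)

/-! ### Generating functions of combinatorial classes -/

section GeneratingFunction

variable {σ T S : Type*} {w : T → σ →₀ ℕ} {w' : S → σ →₀ ℕ}

/-- Only finitely many objects of the class `T` have any given monomial, so that the class has a
generating function. -/
def FiniteFibers (w : T → σ →₀ ℕ) : Prop := ∀ e, {t | w t = e}.Finite

/-- The generating function of a class `T` of objects with monomials `w`: the sum of the monomials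
of all the objects. -/
def gf (w : T → σ →₀ ℕ) : MvPowerSeries σ ℤ := ∑' t, MvPowerSeries.monomial (w t) 1

namespace FiniteFibers

theorem finite_le (hw : FiniteFibers w) (e : σ →₀ ℕ) : {t | w t ≤ e}.Finite := by
  classical
  refine ((Set.finite_Icc 0 e).biUnion fun q _ => hw q).subset fun t ht => ?_
  exact Set.mem_biUnion (show w t ∈ Set.Icc 0 e from ⟨zero_le, ht⟩) rfl

theorem of_le (hw : FiniteFibers w) {w₁ : T → σ →₀ ℕ} (h : w ≤ w₁) : FiniteFibers w₁ :=
  fun e => (hw.finite_le e).subset fun t ht => (h t).trans_eq ht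

theorem comp_injective (hw : FiniteFibers w) {φ : S → T} (hφ : Function.Injective φ) :
    FiniteFibers (w ∘ φ) :=
  fun e => (hw e).preimage hφ.injOn

theorem prod (hw : FiniteFibers w) (hw' : FiniteFibers w') :
    FiniteFibers fun p : T × S => w p.1 + w' p.2 := fun e =>
  ((hw.finite_le e).prod (hw'.finite_le e)).subset fun _ hp =>
    ⟨le_self_add.trans_eq hp, le_add_self.trans_eq hp⟩

theorem pi {ι : Type*} [Fintype ι] (hw : FiniteFibers w) :
    FiniteFibers fun t : ι → T => ∑ i, w (t i) := fun e =>
  (Set.Finite.pi' fun _ => hw.finite_le e).subset fun t ht i =>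
    (Finset.single_le_sum (f := fun i => w (t i)) (fun _ _ => zero_le)
      (Finset.mem_univ i)).trans_eq ht

theorem summable (hw : FiniteFibers w) :
    Summable fun t => (MvPowerSeries.monomial (w t) 1 : MvPowerSeries σ ℤ) := by
  classical
  rw [MvPowerSeries.WithPiTopology.summable_iff_summable_coeff]
  refine fun e => summable_of_hasFiniteSupport ((hw e).subset fun t ht => ?_)
  by_contra hne
  exact ht ((MvPowerSeries.coeff_monomial _ _ _).trans (if_neg (Ne.symm hne)))

end FiniteFibers

theorem coeff_gf (hw : FiniteFibers w) (e : σ →₀ ℕ) :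
    MvPowerSeries.coeff e (gf w) = ({t | w t = e}.ncard : ℤ) := by
  classical
  have h := MvPowerSeries.WithPiTopology.hasSum_iff_hasSum_coeff.1 hw.summable.hasSum e
  rw [gf, ← h.tsum_eq, tsum_eq_sum (s := (hw e).toFinset), Set.ncard_eq_toFinset_card _ (hw e),
    Finset.card_eq_sum_ones, Nat.cast_sum]
  · refine Finset.sum_congr rfl fun t ht => ?_
    rw [MvPowerSeries.coeff_monomial, if_pos ((Set.Finite.mem_toFinset _).1 ht).symm, Nat.cast_one]
  · intro t ht
    rw [MvPowerSeries.coeff_monomial, if_neg]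
    exact fun h' => ht ((Set.Finite.mem_toFinset _).2 h'.symm)

theorem gf_comp_equiv (E : S ≃ T) : gf (w ∘ E) = gf w :=
  E.tsum_eq fun t => MvPowerSeries.monomial (w t) (1 : ℤ)

theorem gf_option {w : Option T → σ →₀ ℕ} (hw : FiniteFibers w) :
    gf w = MvPowerSeries.monomial (w none) 1 + gf fun t => w (some t) := by
  classical
  rw [gf, hw.summable.tsum_eq_add_tsum_ite none, gf,
    ← (Option.some_injective T).tsum_eq fun t ht => ?_]
  · simp only [reduceCtorEq, if_false]
  · cases t with
    | none => exact absurd (if_pos rfl) ht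
    | some t => exact ⟨t, rfl⟩

theorem gf_sigma {ι : Type*} {P : ι → Type*} {w : (Σ i, P i) → σ →₀ ℕ} (hw : FiniteFibers w) :
    gf w = ∑' i, gf fun p : P i => w ⟨i, p⟩ :=
  hw.summable.tsum_sigma' fun _ => (hw.comp_injective sigma_mk_injective).summable

theorem gf_const_add (hw : FiniteFibers w) (d : σ →₀ ℕ) :
    gf (fun t => d + w t) = MvPowerSeries.monomial d 1 * gf w := by
  rw [gf, gf, ← hw.summable.tsum_mul_left]
  simp only [MvPowerSeries.monomial_mul_monomial, one_mul]

theorem gf_prod (hw : FiniteFibers w) (hw' : FiniteFibers w') :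
    gf (fun p : T × S => w p.1 + w' p.2) = gf w * gf w' := by
  have h : ∀ p : T × S, (MvPowerSeries.monomial (w p.1 + w' p.2) 1 : MvPowerSeries σ ℤ) =
      MvPowerSeries.monomial (w p.1) 1 * MvPowerSeries.monomial (w' p.2) 1 := fun p => by
    rw [MvPowerSeries.monomial_mul_monomial, one_mul]
  rw [gf, gf, gf, hw.summable.tsum_mul_tsum hw'.summable ((hw.prod hw').summable.congr h)]
  exact tsum_congr h

theorem gf_pi (hw : FiniteFibers w) (k : ℕ) :
    gf (fun t : Fin k → T => ∑ i, w (t i)) = gf w ^ k := by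
  induction k with
  | zero =>
    rw [gf, tsum_fintype, Fintype.sum_unique, Fin.sum_univ_zero, pow_zero,
      MvPowerSeries.monomial_zero_one]
  | succ k ih =>
    rw [pow_succ', ← ih, ← gf_prod hw hw.pi, ← gf_comp_equiv (Fin.consEquiv fun _ => T)]
    congr 1
    funext p
    exact Fin.sum_univ_succ _

theorem gf_add_ite (hw : FiniteFibers w) {P : T → Prop} [DecidablePred P] {t₀ : T}
    (hP : ∀ t, P t ↔ t = t₀) (h₀ : w t₀ = 0) (d : σ →₀ ℕ) :
    gf (fun t => w t + if P t then d else 0) = gf w - 1 + MvPowerSeries.monomial d (1 : ℤ) := by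
  classical
  have hne : ∀ t, (if t = t₀ then (0 : MvPowerSeries σ ℤ) else
      MvPowerSeries.monomial (w t + if P t then d else 0) 1) =
      if t = t₀ then 0 else MvPowerSeries.monomial (w t) 1 := fun t => by
    split_ifs with ht hPt
    · rfl
    · exact absurd ((hP t).1 hPt) ht
    · rw [add_zero]
  have hw₁ : FiniteFibers fun t => w t + if P t then d else 0 := hw.of_le fun _ => le_self_add
  rw [gf, gf, hw.summable.tsum_eq_add_tsum_ite t₀, hw₁.summable.tsum_eq_add_tsum_ite t₀,
    tsum_congr hne, if_pos ((hP t₀).2 rfl), h₀, zero_add, MvPowerSeries.monomial_zero_one]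
  ring

theorem gf_pi_add_ite (hw : FiniteFibers w) {k : ℕ} {P : (Fin k → T) → Prop} [DecidablePred P]
    {t₀ : T} (hP : ∀ t, P t ↔ ∀ i, t i = t₀) (h₀ : w t₀ = 0) (d : σ →₀ ℕ) :
    gf (fun t : Fin k → T => ∑ i, w (t i) + if P t then d else 0) =
      gf w ^ k - 1 + MvPowerSeries.monomial d 1 := by
  rw [gf_add_ite hw.pi (t₀ := fun _ => t₀) (fun t => (hP t).trans funext_iff.symm)
    (Finset.sum_eq_zero fun _ _ => h₀), gf_pi hw]

end GeneratingFunction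

/-! ### The exchange of variables -/

theorem mapDomain_swapVar_swapVar (e : Var →₀ ℕ) :
    (e.mapDomain swapVar).mapDomain swapVar = e := by
  have hinv : (swapVar ∘ swapVar : Var → Var) = id := funext swapVar.left_inv
  rw [← Finsupp.mapDomain_comp, hinv, Finsupp.mapDomain_id]

theorem mapDomain_swapVar_eq_iff {e e' : Var →₀ ℕ} :
    e.mapDomain swapVar = e' ↔ e = e'.mapDomain swapVar :=
  Function.Involutive.eq_iff mapDomain_swapVar_swapVar

theorem coeff_hat (h : Series) (e : Var →₀ ℕ) :
    MvPowerSeries.coeff e (hat h) = MvPowerSeries.coeff (e.mapDomain swapVar) h := by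
  have hren := MvPowerSeries.coeff_embDomain_rename swapVar.toEmbedding h (e.mapDomain swapVar)
  rw [Finsupp.embDomain_eq_mapDomain] at hren
  change MvPowerSeries.coeff ((e.mapDomain swapVar).mapDomain swapVar) (hat h) = _ at hren
  rwa [mapDomain_swapVar_swapVar] at hren

theorem hat_hat (h : Series) : hat (hat h) = h := by
  ext e
  rw [coeff_hat, coeff_hat, mapDomain_swapVar_swapVar]

theorem hat_sub (a b : Series) : hat (a - b) = hat a - hat b := map_sub _ a b

theorem hat_mul (a b : Series) : hat (a * b) = hat a * hat b := map_mul _ a b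

theorem hat_pow (a : Series) (k : ℕ) : hat (a ^ k) = hat a ^ k := map_pow _ a k

theorem hat_one : hat 1 = 1 := map_one _

theorem hat_X (i : Var) : hat (MvPowerSeries.X i) = MvPowerSeries.X (swapVar i) :=
  MvPowerSeries.rename_X _ i

theorem hat_v (j : Len) : hat (v j) = u j := hat_X _

theorem FiniteFibers.mapDomain_swapVar {T : Type*} {w : T → Var →₀ ℕ} (hw : FiniteFibers w) :
    FiniteFibers fun t => (w t).mapDomain swapVar := fun e => by
  simpa only [mapDomain_swapVar_eq_iff] using hw (e.mapDomain swapVar)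

theorem hat_gf {T : Type*} {w : T → Var →₀ ℕ} (hw : FiniteFibers w) :
    hat (gf w) = gf fun t => (w t).mapDomain swapVar := by
  ext e
  rw [coeff_hat, coeff_gf hw, coeff_gf hw.mapDomain_swapVar]
  simp only [mapDomain_swapVar_eq_iff]

/-! ### Sums over the lengths of cycles -/

/-- The series `∑ x_n * G_n`. -/
def xsum (G : Len → Series) : Series := ∑' n : Len, x n * G n

theorem xsum_add (G H : Len → Series) : xsum (fun n => G n + H n) = xsum G + xsum H := by
  simp only [xsum, mul_add]
  exact (summable_x_mul G).tsum_add (summable_x_mul H)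

theorem xsum_sub (G H : Len → Series) : xsum (fun n => G n - H n) = xsum G - xsum H := by
  simp only [xsum, mul_sub]
  exact (summable_x_mul G).tsum_sub (summable_x_mul H)

theorem xsum_mul (G : Len → Series) (a : Series) : xsum (fun n => G n * a) = xsum G * a := by
  simp only [xsum, ← mul_assoc]
  exact (summable_x_mul G).tsum_mul_right a

theorem coeff_xsum (G : Len → Series) (e : Var →₀ ℕ) :
    MvPowerSeries.coeff e (xsum G) = ∑' n, MvPowerSeries.coeff e (x n * G n) :=
  (MvPowerSeries.WithPiTopology.hasSum_iff_hasSum_coeff.1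
    (summable_x_mul G).hasSum e).tsum_eq.symm

theorem hat_xsum (G : Len → Series) : hat (xsum G) = xsum fun n => hat (G n) := by
  ext e
  rw [coeff_hat, coeff_xsum, coeff_xsum]
  refine tsum_congr fun n => ?_
  rw [← coeff_hat, hat_mul, x, hat_X]
  rfl

/-! ### Uniqueness of the solution -/

/-- The ideal of the series without terms of degree less than `N`. Two series agree modulo it if
they have the same terms in these degrees. -/
def lowIdeal (N : ℕ) : Ideal Series where
  carrier := {h | (N : ℕ∞) ≤ h.order}
  add_mem' ha hb := (le_min ha hb).trans MvPowerSeries.min_order_le_add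
  zero_mem' := MvPowerSeries.le_order fun _ _ => rfl
  smul_mem' c _ ha := (le_add_left ha).trans (MvPowerSeries.le_order_mul (f := c))

theorem mem_lowIdeal {N : ℕ} {h : Series} :
    h ∈ lowIdeal N ↔ ∀ e, Finsupp.degree e < N → MvPowerSeries.coeff e h = 0 :=
  ⟨fun hh _ he => MvPowerSeries.coeff_of_lt_order ((Nat.cast_lt.2 he).trans_le hh),
    MvPowerSeries.nat_le_order⟩

theorem hat_mem_lowIdeal {N : ℕ} {h : Series} (hh : h ∈ lowIdeal N) : hat h ∈ lowIdeal N := by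
  rw [mem_lowIdeal] at hh ⊢
  intro e he
  rw [coeff_hat]
  exact hh _ (by rwa [Finsupp.degree_mapDomain])

theorem x_mul_mem_lowIdeal {N : ℕ} {h : Series} (hh : h ∈ lowIdeal N) (n : Len) :
    x n * h ∈ lowIdeal (N + 1) := by
  have hx : (x n).order = 1 := by
    rw [x, MvPowerSeries.X, MvPowerSeries.order_monomial, if_neg one_ne_zero,
      Finsupp.degree_single, Nat.cast_one]
  calc ((N + 1 : ℕ) : ℕ∞) = 1 + N := by rw [Nat.cast_add, Nat.cast_one, add_comm]
    _ ≤ (x n).order + h.order := add_le_add hx.ge hh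
    _ ≤ (x n * h).order := MvPowerSeries.le_order_mul

theorem xsum_mem_lowIdeal {N : ℕ} {G : Len → Series} (hG : ∀ n, G n ∈ lowIdeal N) :
    xsum G ∈ lowIdeal (N + 1) := by
  refine mem_lowIdeal.2 fun e he => ?_
  rw [coeff_xsum, tsum_congr fun n => mem_lowIdeal.1 (x_mul_mem_lowIdeal (hG n) n) e he, tsum_zero]

theorem SolvesRecursion.sub_mem_lowIdeal {f f' : Series} (hf : SolvesRecursion f)
    (hf' : SolvesRecursion f') (N : ℕ) : f - f' ∈ lowIdeal N := by
  induction N with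
  | zero => exact mem_lowIdeal.2 fun e he => absurd he (Nat.not_lt_zero _)
  | succ N ih =>
    have hmk := Ideal.Quotient.eq.2 ih
    have hmk_hat := Ideal.Quotient.eq.2 (hat_sub f f' ▸ hat_mem_lowIdeal ih)
    have hsub : f - f' = xsum (fun n : Len => (f ^ n.1 - 1 + v n) * hat f ^ (n.1 - 1) -
        (f' ^ n.1 - 1 + v n) * hat f' ^ (n.1 - 1)) := by
      rw [xsum_sub]
      conv_lhs => rw [hf, hf']
      exact add_sub_add_left_eq_sub _ _ _
    rw [hsub]
    refine xsum_mem_lowIdeal fun n => Ideal.Quotient.eq.1 ?_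
    simp only [map_mul, map_pow, map_add, map_sub, hmk, hmk_hat]

theorem SolvesRecursion.unique {f f' : Series} (hf : SolvesRecursion f)
    (hf' : SolvesRecursion f') : f = f' := by
  ext e
  have hmem := mem_lowIdeal.1 (hf.sub_mem_lowIdeal hf' (e.degree + 1)) e (Nat.lt_succ_self _)
  rwa [map_sub, sub_eq_zero] at hmem

/-! ### The generating functions of trees -/

theorem len_injective : Function.Injective len := fun _ _ h =>
  Nat.add_right_cancel (congrArg Subtype.val h)

theorem len_surjective : Function.Surjective len := fun j =>
  ⟨j.1 - 2, Subtype.ext (Nat.sub_add_cancel j.2)⟩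

theorem degree_lt_of_add_single_le {σ : Type*} {i : σ} {q e : σ →₀ ℕ}
    (h : q + Finsupp.single i 1 ≤ e) : q.degree < e.degree := by
  have hdeg := Finsupp.degree_mono h
  rwa [map_add, Finsupp.degree_single] at hdeg

namespace Tree

section Weight

variable (m : ℕ) (b : Fin (m + 2) → Tree) (a : Fin (m + 1) → Tree)

theorem weight_right_add_single_le (i : Fin (m + 2)) :
    (b i).weight + Finsupp.single (Var.x (len m)) 1 ≤ (node m b a).weight := by
  rw [weight, add_comm]
  exact le_add_right (add_le_add le_self_add
    (Finset.single_le_sum (f := fun i => (b i).weight) (fun _ _ => zero_le) (Finset.mem_univ i)))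

theorem weight_left_add_single_le (i : Fin (m + 1)) :
    (a i).weight.mapDomain swapVar + Finsupp.single (Var.x (len m)) 1 ≤
      (node m b a).weight := by
  rw [weight, add_comm, add_assoc]
  exact add_le_add le_self_add (le_add_left
    (Finset.single_le_sum (f := fun i => (a i).weight.mapDomain swapVar) (fun _ _ => zero_le)
      (Finset.mem_univ i)))

end Weight

theorem finite_weight_eq (N : ℕ) (e : Var →₀ ℕ) (he : e.degree < N) :
    {t : Tree | t.weight = e}.Finite := by
  classical
  induction N generalizing e with
  | zero => exact absurd he (Nat.not_lt_zero _)
  | succ N ih =>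
    have hmirror : ∀ q : Var →₀ ℕ, q.degree < N →
        {t : Tree | t.weight.mapDomain swapVar = q}.Finite := fun q hq => by
      simpa only [mapDomain_swapVar_eq_iff] using
        ih (q.mapDomain swapVar) (by rwa [Finsupp.degree_mapDomain])
    have hI : (Set.Icc 0 e ∩ {q | q.degree < N}).Finite := (Set.finite_Icc 0 e).inter_of_left _
    have hm : (len ⁻¹' (Var.x ⁻¹' (e.support : Set Var))).Finite :=
      (e.support.finite_toSet.preimage fun _ _ _ _ => Var.x.inj).preimage len_injective.injOn
    have hmem : ∀ {m} {q : Var →₀ ℕ}, q + Finsupp.single (Var.x (len m)) 1 ≤ e →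
        q ∈ Set.Icc 0 e ∩ {q | q.degree < N} := fun hq =>
      ⟨⟨zero_le, le_self_add.trans hq⟩,
        (degree_lt_of_add_single_le hq).trans_le (Nat.le_of_lt_succ he)⟩
    refine ((hm.biUnion fun m _ =>
      ((Set.Finite.pi' fun _ : Fin (m + 2) => hI.biUnion fun q hq => ih q hq.2).prod
        (Set.Finite.pi' fun _ : Fin (m + 1) => hI.biUnion fun q hq => hmirror q hq.2)).image
        fun p => node m p.1 p.2).insert nil).subset ?_
    rintro (_ | ⟨m, b, a⟩) ht
    · exact Or.inl rfl
    have hb := fun i => (weight_right_add_single_le m b a i).trans_eq ht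
    have ha := fun i => (weight_left_add_single_le m b a i).trans_eq ht
    have hxm : Var.x (len m) ∈ e.support := Finsupp.mem_support_iff.2 fun h0 => by
      have hle := (le_add_self.trans (hb 0)) (Var.x (len m))
      rw [Finsupp.single_eq_same, h0] at hle
      exact absurd hle (Nat.not_succ_le_zero 0)
    exact Or.inr (Set.mem_biUnion (show m ∈ _ from hxm) ⟨(b, a),
      ⟨fun i => Set.mem_biUnion (hmem (hb i)) rfl, fun i => Set.mem_biUnion (hmem (ha i)) rfl⟩,
      rfl⟩)

theorem finiteFibers_weight : FiniteFibers weight := fun e =>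
  finite_weight_eq _ e (Nat.lt_succ_self _)

theorem finiteFibers_fullWeight : FiniteFibers fullWeight :=
  finiteFibers_weight.of_le fun t => by
    cases t with
    | nil => exact zero_le
    | node m b a => exact le_self_add

/-- A nonempty tree amounts to the length of the cycle at its root and the branches there. -/
def optionEquiv : Option (Σ m : ℕ, (Fin (m + 2) → Tree) × (Fin (m + 1) → Tree)) ≃ Tree where
  toFun
    | none => nil
    | some ⟨m, b, a⟩ => node m b a
  invFun
    | nil => none
    | node m b a => some ⟨m, b, a⟩
  left_inv := by rintro (_ | ⟨m, b, a⟩) <;> rfl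
  right_inv := by rintro (_ | ⟨m, b, a⟩) <;> rfl

theorem gf_eq_one_add_xsum {w : Tree → Var →₀ ℕ} (hw : FiniteFibers w) (h₀ : w nil = 0)
    {wb : ∀ m, (Fin (m + 2) → Tree) → Var →₀ ℕ} {wa : ∀ m, (Fin (m + 1) → Tree) → Var →₀ ℕ}
    (hwb : ∀ m, FiniteFibers (wb m)) (hwa : ∀ m, FiniteFibers (wa m))
    (h : ∀ m b a, w (node m b a) = Finsupp.single (Var.x (len m)) 1 + (wb m b + wa m a))
    {G : Len → Series} (hG : ∀ m, G (len m) = gf (wb m) * gf (wa m)) :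
    gf w = 1 + xsum G := by
  have hopt : FiniteFibers (w ∘ optionEquiv) := hw.comp_injective optionEquiv.injective
  have hsome : FiniteFibers fun p => (w ∘ optionEquiv) (some p) :=
    hopt.comp_injective (Option.some_injective _)
  rw [← gf_comp_equiv optionEquiv, gf_option hopt, gf_sigma hsome, xsum,
    ← (Equiv.ofBijective len ⟨len_injective, len_surjective⟩).tsum_eq]
  congr 1
  · exact (congrArg (MvPowerSeries.monomial · 1) h₀).trans MvPowerSeries.monomial_zero_one
  · refine tsum_congr fun m => ?_
    calc gf (fun p : (Fin (m + 2) → Tree) × (Fin (m + 1) → Tree) => w (node m p.1 p.2))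
        = gf fun p : (Fin (m + 2) → Tree) × (Fin (m + 1) → Tree) =>
            Finsupp.single (Var.x (len m)) 1 + (wb m p.1 + wa m p.2) := by simp only [h]
      _ = x (len m) * G (len m) := by
          rw [gf_const_add ((hwb m).prod (hwa m)), gf_prod (hwb m) (hwa m), hG]
          rfl

theorem solvesRecursion_gf_weight : SolvesRecursion (gf weight) := by
  classical
  have hw := finiteFibers_weight
  refine gf_eq_one_add_xsum
    (wb := fun m b => ∑ i, (b i).weight +
      if ∀ i, b i = nil then Finsupp.single (Var.v (len m)) 1 else 0)
    (wa := fun _ a => ∑ i, (a i).weight.mapDomain swapVar)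
    hw rfl (fun _ => hw.pi.of_le fun _ => le_self_add) (fun _ => hw.mapDomain_swapVar.pi)
    (fun m b a => ?_) fun m => ?_
  · rw [weight]
    abel
  · rw [gf_pi_add_ite hw (fun _ => Iff.rfl) rfl, gf_pi hw.mapDomain_swapVar, hat_gf hw]
    rfl

theorem gf_fullWeight : gf fullWeight = 1 + xsum fun n =>
    (gf weight ^ n.1 - 1 + v n) * (hat (gf weight) ^ (n.1 - 1) - 1 + u n) := by
  classical
  have hw := finiteFibers_weight
  refine gf_eq_one_add_xsum
    (wb := fun m b => ∑ i, (b i).weight +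
      if ∀ i, b i = nil then Finsupp.single (Var.v (len m)) 1 else 0)
    (wa := fun m a => ∑ i, (a i).weight.mapDomain swapVar +
      if ∀ i, a i = nil then Finsupp.single (Var.u (len m)) 1 else 0)
    finiteFibers_fullWeight rfl (fun _ => hw.pi.of_le fun _ => le_self_add)
    (fun _ => hw.mapDomain_swapVar.pi.of_le fun _ => le_self_add) (fun m b a => ?_) fun m => ?_
  · rw [fullWeight, weight]
    abel
  · rw [gf_pi_add_ite hw (fun _ => Iff.rfl) rfl,
      gf_pi_add_ite hw.mapDomain_swapVar (fun _ => Iff.rfl) Finsupp.mapDomain_zero, hat_gf hw]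
    rfl

end Tree

/-! ### The two expressions for `g` -/

theorem g_eq_gf : g = gf Tree.fullWeight := by
  ext e
  rw [coeff_g, coeff_gf Tree.finiteFibers_fullWeight]

namespace SolvesRecursion

variable {f : Series}

theorem eq_one_add_xsum (hf : SolvesRecursion f) :
    f = 1 + xsum fun n => (f ^ n.1 - 1 + v n) * hat f ^ (n.1 - 1) := hf

theorem g_eq_one_add_xsum (hf : SolvesRecursion f) : g = 1 + xsum fun n =>
    (f ^ n.1 - 1 + v n) * (hat f ^ (n.1 - 1) - 1 + u n) := by
  rw [hf.unique Tree.solvesRecursion_gf_weight, g_eq_gf, Tree.gf_fullWeight]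

theorem g_eq (hf : SolvesRecursion f) :
    g = f - xsum (fun n => (1 - u n) * f ^ n.1) + xsum fun n => (1 - u n) * (1 - v n) := by
  conv_rhs => enter [1, 1]; rw [hf.eq_one_add_xsum]
  rw [hf.g_eq_one_add_xsum, add_sub_assoc, add_assoc, ← xsum_sub, ← xsum_add]
  congr 2
  funext n
  ring

theorem mul_hat_eq (hf : SolvesRecursion f) :
    f * hat f =
      hat f + xsum (fun n => (f * hat f) ^ n.1) - xsum fun n => (1 - v n) * hat f ^ n.1 := by
  conv_lhs => enter [1]; rw [hf.eq_one_add_xsum]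
  rw [add_mul, one_mul, ← xsum_mul, add_sub_assoc, ← xsum_sub]
  congr 2
  funext n
  rw [mul_assoc, ← pow_succ, Nat.sub_add_cancel (one_le_two.trans n.2), mul_pow]
  ring

-- The left side is invariant under `hat`, so this is `hat` applied to `mul_hat_eq`.
theorem mul_hat_sub_xsum (hf : SolvesRecursion f) :
    f * hat f - xsum (fun n => (f * hat f) ^ n.1) = f - xsum fun n => (1 - u n) * f ^ n.1 := by
  have hhat := congrArg hat (sub_eq_iff_eq_add.2 (hf.mul_hat_eq.trans (add_sub_right_comm _ _ _)))
  simpa only [hat_sub, hat_mul, hat_hat, hat_xsum, hat_pow, hat_one, hat_v, mul_comm (hat f) f]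
    using hhat

theorem g_eq_mul_hat (hf : SolvesRecursion f) :
    g = f * hat f - xsum (fun n => (f * hat f) ^ n.1) +
      xsum fun n => (1 - u n) * (1 - v n) :=
  hf.g_eq.trans (congrArg (· + _) hf.mul_hat_sub_xsum.symm)

end SolvesRecursion

end CycleFactorization

end

theorem theorem3 :
    (∃! f : CycleFactorization.Series, CycleFactorization.SolvesRecursion f) ∧
    ∀ f : CycleFactorization.Series, CycleFactorization.SolvesRecursion f →
      (CycleFactorization.g =
        f - ∑' n : CycleFactorization.Len,
              CycleFactorization.x n * ((1 - CycleFactorization.u n) * f ^ n.1)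
          + ∑' n : CycleFactorization.Len,
              CycleFactorization.x n *
                ((1 - CycleFactorization.u n) * (1 - CycleFactorization.v n))) ∧
      (CycleFactorization.g =
        f * CycleFactorization.hat f
          - ∑' n : CycleFactorization.Len,
              CycleFactorization.x n * (f * CycleFactorization.hat f) ^ n.1
          + ∑' n : CycleFactorization.Len,
              CycleFactorization.x n *
                ((1 - CycleFactorization.u n) * (1 - CycleFactorization.v n))) := by
  refine ⟨⟨_, CycleFactorization.Tree.solvesRecursion_gf_weight, fun f hf => ?_⟩,
    fun f hf => ⟨hf.g_eq, hf.g_eq_mul_hat⟩⟩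
  exact hf.unique CycleFactorization.Tree.solvesRecursion_gf_weight
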